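/- Let $\phi^*u(t)=u(-t)$, $Du=u'$, and let $\mathbb R[D,\phi^*]$ be the algebra of operators $\sum_i a_i\phi^*D^i+\sum_j b_jD^j$ (finite sums, real coefficients) under composition, so that $D\phi^*=-\phi^*D$; it contains the algebra $\mathbb R[D]$ of constant-coefficient differential operators. For $u$ defined on $I=[-T,T]$, $(\phi^*D^iu)(t)=u^{(i)}(-t)$. For $n\ge 1$, $W^{n,1}(I)$ denotes the functions $u$ such that $u,\dots,u^{(n-1)}$ exist and are absolutely continuous on $I$. **Theorem.** Let $L=\sum_i a_i\phi^*D^i+\sum_j b_jD^j\in\mathbb R[D,\phi^*]$ and put $$R=\sum_k a_k\phi^*D^k+\sum_l(-1)^{l+1}b_lD^l\in\mathbb R[D,\phi^*].$$ Then $S:=RL\in\mathbb R[D]$. Moreover, let $T>0$, $I=[-T,T]$, $n\ge1$, and suppose that $L$ has order at most $n$ (that is, $a_i=b_i=0$ for $i>n$) and that $S$ has order $2n$ (equivalently, $a_n^2\ne b_n^2$). Let $\alpha_{ij},\beta_{ij}\in\mathbb R$ and $$B_iu=\sum_{j=0}^{n-1}\left(\alpha_{ij}u^{(j)}(-T)+\beta_{ij}u^{(j)}(T)\right),\qquad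 i=1,\dots,n,$$ and suppose that the reduced homogeneous problem $$Su=0 \text{ on } I,\qquad B_iRu=0,\quad B_iu=0,\qquad i=1,\dots,n,$$ has only the trivial solution in $W^{2n,1}(I)$. Then this reduced problem has a unique Green's function $G:I^2\to\mathbb R$, that is, a unique function $G$ such that, with $m=2n$ and $c_m$ the leading coefficient of $S$: 1. $\partial^kG/\partial t^k$ exists and is continuous on $I^2$ for $0\le k\le m-2$; 2. $\partial^{m-1}G/\partial t^{m-1}$ and $\partial^{m}G/\partial t^{m}$ exist and are continuous on $I^2\setminus\{(t,t):t\in I\}$; 3. for every $t\in(-T,T)$ the one-sided limits (in the second variable) $\frac{\partial^{m-1}G}{\partial t^{m-1}}(t,t^-)$ and $\frac{\partial^{m-1}G}{\partial t^{m-1}}(t,t^+)$ exist, and the first minus the second equals $1/c_m$; 4. for every $s\in(-T,T)$, $G(\cdot,s)$ satisfies $Su=0$ on $I\setminus\{s\}$; 5. for every $s\in(-T,T)$, $u=G(\cdot,s)$ satisfies $B_iRu=0$ and $B_iu=0$ for $i=1,\dots,n$. Furthermore, writing $R_\vdash G(t,s):=R(G(\cdot,s))(t)$, for every $h\in L^1(I)$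 and every $t\in I$ the function $s\mapsto R_\vdash G(t,s)h(s)$ is integrable on $I$, and $$u(t)=\int_{-T}^{T}R_\vdash G(t,s)\,h(s)\,ds,\qquad t\in I,$$ is the unique function $u\in W^{n,1}(I)$ such that $Lu(t)=h(t)$ for almost every $t\in I$ and $B_iu=0$ for $i=1,\dots,n$. -/

import Mathlib

open Set Filter Topology MeasureTheory
open scoped Polynomial

namespace ReflectionBVP

noncomputable section

/-- An element `φ* P(D) + Q(D)` of the algebra `ℝ[D, φ*]`, where `φ* u (t) = u (-t)`:
`refl = P` holds the coefficients of the `φ* D ^ i` and `plain = Q` those of the `D ^ j`. -/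
@[ext]
structure ReflOp where
  refl : ℝ[X]
  plain : ℝ[X]

namespace ReflOp

/-- The product (composition) in `ℝ[D, φ*]`. It is determined by `φ* φ* = 1` and `D φ* = - φ* D`,
that is `P(D) φ* = φ* P(-D)`. -/
instance : Mul ReflOp where
  mul A B :=
    { refl := A.refl * B.plain + A.plain.comp (-Polynomial.X) * B.refl
      plain := A.refl.comp (-Polynomial.X) * B.refl + A.plain * B.plain }

/-- The inclusion `ℝ[D] ⊆ ℝ[D, φ*]`. -/
def ofPoly (S : ℝ[X]) : ReflOp where
  refl := 0
  plain := S

end ReflOp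

/-- The differential expression `P(D) u = ∑ k, p_k u^(k)` at `t`, derivatives being taken within
the set `J` (so one-sided at an endpoint of an interval). -/
def diffOp (P : ℝ[X]) (J : Set ℝ) (u : ℝ → ℝ) (t : ℝ) : ℝ :=
  P.sum fun k c => c * iteratedDerivWithin k u J t

/-- The action `L u (t) = ∑ i, a_i u^(i)(-t) + ∑ j, b_j u^(j)(t)` of `L ∈ ℝ[D, φ*]` on functions
on `J`. -/
def ReflOp.act (L : ReflOp) (J : Set ℝ) (u : ℝ → ℝ) (t : ℝ) : ℝ :=
  diffOp L.refl J u (-t) + diffOp L.plain J u t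

/-- `L_⊢ G (t, s) = L (G (·, s)) (t)`. -/
def ReflOp.turnstile (L : ReflOp) (J : Set ℝ) (G : ℝ → ℝ → ℝ) (t s : ℝ) : ℝ :=
  L.act J (fun τ => G τ s) t

/-- The Sobolev space `W^{m,1}([-T, T])`, `m ≥ 1`, in its continuous representatives:
`u, u', …, u^(m-1)` exist and are absolutely continuous on `[-T, T]`. -/
def IsSobolev (T : ℝ) (m : ℕ) (u : ℝ → ℝ) : Prop :=
  ∀ k : ℕ, k < m → ContDiffOn ℝ k u (Icc (-T) T) ∧
    AbsolutelyContinuousOnInterval (iteratedDerivWithin k u (Icc (-T) T)) (-T) T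

/-- The two-point functional
`B_i u = ∑_{j=0}^{n-1} (α_ij u^(j)(-T) + β_ij u^(j)(T))`. -/
def bdry (T : ℝ) {n : ℕ} (α β : Fin n → Fin n → ℝ) (i : Fin n) (u : ℝ → ℝ) : ℝ :=
  ∑ j : Fin n, (α i j * iteratedDerivWithin j u (Icc (-T) T) (-T) +
    β i j * iteratedDerivWithin j u (Icc (-T) T) T)

/-- The boundary conditions of the reduced problem: the functionals `u ↦ B_i (R u)` and `B_i`. -/
def reducedBdry (T : ℝ) {n : ℕ} (α β : Fin n → Fin n → ℝ) (R : ReflOp) :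
    Fin n ⊕ Fin n → (ℝ → ℝ) → ℝ
  | Sum.inl i => fun u => bdry T α β i (R.act (Icc (-T) T) u)
  | Sum.inr i => bdry T α β i

/-- `u ∈ W^{m,1}([-T, T])` solves `L u = h` almost everywhere on `[-T, T]`, with the homogeneous
conditions `C_i u = 0`; here `m` is the order of `L`. -/
structure IsSolution {ι : Type} (T : ℝ) (m : ℕ) (L : ReflOp) (C : ι → (ℝ → ℝ) → ℝ)
    (h u : ℝ → ℝ) : Prop where
  regular : IsSobolev T m u
  equation : ∀ᵐ t ∂(volume.restrict (Icc (-T) T)), L.act (Icc (-T) T) u t = h t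
  conditions : ∀ i, C i u = 0

/-- `G` is a Green's function on `[-T, T]²` of the problem `S u = f`, `C_i u = 0`, where
`S ∈ ℝ[D]` has order `m = S.natDegree`. Only the values of `G` on the square matter. -/
structure IsGreen {ι : Type} (T : ℝ) (S : ℝ[X]) (C : ι → (ℝ → ℝ) → ℝ) (G : ℝ → ℝ → ℝ) :
    Prop where
  /-- `∂^k G / ∂t^k` exists on the square for `k ≤ m - 2` … -/
  exists_low : ∀ k : ℕ, k + 2 ≤ S.natDegree → ∀ s ∈ Icc (-T) T,
    ContDiffOn ℝ k (fun t => G t s) (Icc (-T) T)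
  /-- … and is jointly continuous there. -/
  continuous_low : ∀ k : ℕ, k + 2 ≤ S.natDegree →
    ContinuousOn (fun p : ℝ × ℝ => iteratedDerivWithin k (fun t => G t p.2) (Icc (-T) T) p.1)
      (Icc (-T) T ×ˢ Icc (-T) T)
  /-- `∂^k G / ∂t^k`, `k = m - 1, m`, exists off the diagonal … -/
  exists_high : ∀ s ∈ Icc (-T) T,
    ContDiffOn ℝ S.natDegree (fun t => G t s) (Icc (-T) T \ {s})
  /-- … and is jointly continuous there. -/
  continuous_high : ∀ k : ℕ, k ≤ S.natDegree → S.natDegree ≤ k + 1 →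
    ContinuousOn
      (fun p : ℝ × ℝ => iteratedDerivWithin k (fun t => G t p.2) (Icc (-T) T \ {p.2}) p.1)
      ((Icc (-T) T ×ˢ Icc (-T) T) \ {p | p.1 = p.2})
  /-- The lateral limits of `∂^(m-1) G / ∂t^(m-1)` at `(t, t⁻)` and `(t, t⁺)` exist, and their
  difference is the inverse of the leading coefficient of `S`. -/
  jump : ∀ k : ℕ, k + 1 = S.natDegree → ∀ t ∈ Ioo (-T) T, ∃ below above : ℝ,
    Tendsto (fun s => iteratedDerivWithin k (fun τ => G τ s) (Icc (-T) T \ {s}) t)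
      (𝓝[<] t) (𝓝 below) ∧
    Tendsto (fun s => iteratedDerivWithin k (fun τ => G τ s) (Icc (-T) T \ {s}) t)
      (𝓝[>] t) (𝓝 above) ∧
    below - above = 1 / S.leadingCoeff
  /-- `S (G (·, s)) = 0` on `[-T, T] \ {s}`. -/
  equation : ∀ s ∈ Ioo (-T) T, ∀ t ∈ Icc (-T) T \ {s},
    diffOp S (Icc (-T) T \ {s}) (fun τ => G τ s) t = 0
  /-- `G (·, s)` satisfies the boundary conditions. -/
  conditions : ∀ s ∈ Ioo (-T) T, ∀ i, C i (fun t => G t s) = 0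

end

end ReflectionBVP

/-!
A function on `[-T, T]` is replaced by the sequence of its derivatives, its jet. On jets `ℝ[D, φ*]`
acts by linear maps, so that `R L = L R = S` holds without any differentiability assumption.

The Green's function is the causal fundamental solution of `S` corrected by a combination of the
solutions of `S u = 0` dual to the boundary functionals. Integrating it against `h` gives `U` in
`W^{2n,1}` with `S U = h`, `B_i R U = 0` and `B_i U = 0`. Hence `u = R U` satisfies
`L u = L R U = h` and `B_i u = 0`.

For uniqueness, pairing `t` with `-t` turns `L u = 0` into a regular first-order system, because
`a_n² ≠ b_n²`; so the data at `0` determine `u`, and the solutions of `L u = 0` form a space of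
dimension at most `n`. As `L R = S`, the operator `R` maps the solutions of `S u = 0` dual to the
functionals `B_i R` to solutions of `L u = 0`, on which the `B_i` take all values; so the `B_i`
separate the solutions of `L u = 0`.
-/

namespace ReflectionBVP

noncomputable section

open Polynomial (aeval)

/-! ### Jets and the algebra of operators -/

/-- Formal jets: sequences of functions, the `k`-th entry standing for the `k`-th derivative.
On jets differentiation is defined everywhere, so that `ℝ[D, φ*]` acts by endomorphisms. -/
abbrev Jet : Type := ℕ → ℝ → ℝ

namespace Jet

/-- Formal differentiation of jets. -/
def shift : Module.End ℝ Jet where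
  toFun F k t := F (k + 1) t
  map_add' _ _ := rfl
  map_smul' _ _ := rfl

/-- The jet of `t ↦ u (-t)`. -/
def reflect : Module.End ℝ Jet where
  toFun F k t := (-1) ^ k * F k (-t)
  map_add' F G := by ext k t; simp [mul_add]
  map_smul' c F := by ext k t; simp; ring

/-- The jet of `t ↦ u (t - a)`. -/
def translate (a : ℝ) : Module.End ℝ Jet where
  toFun F k t := F k (t - a)
  map_add' _ _ := rfl
  map_smul' _ _ := rfl

@[simp] lemma shift_apply (F : Jet) (k : ℕ) (t : ℝ) : shift F k t = F (k + 1) t := rfl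

@[simp] lemma reflect_apply (F : Jet) (k : ℕ) (t : ℝ) :
    reflect F k t = (-1) ^ k * F k (-t) := rfl

@[simp] lemma translate_apply (a : ℝ) (F : Jet) (k : ℕ) (t : ℝ) :
    translate a F k t = F k (t - a) := rfl

lemma shift_pow_apply (i : ℕ) (F : Jet) (k : ℕ) (t : ℝ) : (shift ^ i) F k t = F (k + i) t := by
  induction i generalizing k with
  | zero => rfl
  | succ i ih => rw [pow_succ', Module.End.mul_apply, shift_apply, ih, add_right_comm, add_assoc]

lemma aeval_shift_apply (P : ℝ[X]) (F : Jet) (k : ℕ) (t : ℝ) :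
    aeval shift P F k t = P.sum fun i c => c * F (k + i) t := by
  rw [Polynomial.aeval_eq_sum_range, Polynomial.sum_over_range _ (by simp)]
  simp [LinearMap.sum_apply, Finset.sum_apply, shift_pow_apply]

lemma aeval_shift_apply_of_le {P : ℝ[X]} {n : ℕ} (hP : P.natDegree ≤ n) (F : Jet) (k : ℕ)
    (t : ℝ) : aeval shift P F k t = ∑ i ∈ Finset.range (n + 1), P.coeff i * F (k + i) t := by
  rw [aeval_shift_apply, Polynomial.sum_over_range' _ (by simp) _ (Nat.lt_succ_of_le hP)]

lemma reflect_mul_reflect : reflect * reflect = 1 := by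
  ext F k t
  simp [← mul_assoc, ← mul_pow]

lemma shift_mul_reflect : shift * reflect = reflect * (-shift) := by
  ext F k t
  simp [pow_succ]

lemma aeval_shift_mul_reflect (P : ℝ[X]) :
    aeval shift P * reflect = reflect * aeval shift (P.comp (-Polynomial.X)) := by
  have shift_pow_mul_reflect (i : ℕ) : shift ^ i * reflect = reflect * (-shift) ^ i :=
    (show SemiconjBy reflect (-shift) shift from shift_mul_reflect.symm).pow_right i |>.symm
  induction P using Polynomial.induction_on' with
  | add p q hp hq => rw [map_add, add_mul, hp, hq, Polynomial.add_comp, map_add, mul_add]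
  | monomial i c =>
    simp only [Polynomial.aeval_monomial, Polynomial.monomial_comp, map_mul, map_pow, map_neg,
      Polynomial.aeval_X, Polynomial.aeval_C]
    rw [mul_assoc, shift_pow_mul_reflect, Algebra.left_comm]

end Jet

open Jet

namespace ReflOp

/-- The order of `φ* P(D) + Q(D)`: the largest order of a derivative occurring in it. -/
def order (L : ReflOp) : ℕ := max L.refl.natDegree L.plain.natDegree

lemma order_le_iff {L : ReflOp} {n : ℕ} :
    L.order ≤ n ↔ L.refl.natDegree ≤ n ∧ L.plain.natDegree ≤ n := max_le_iff

/-- The action of `ℝ[D, φ*]` on jets. -/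
def toEnd (L : ReflOp) : Module.End ℝ Jet :=
  reflect * aeval shift L.refl + aeval shift L.plain

lemma toEnd_apply (L : ReflOp) (F : Jet) (k : ℕ) (t : ℝ) :
    L.toEnd F k t = (-1) ^ k * aeval shift L.refl F k (-t) + aeval shift L.plain F k t := rfl

lemma toEnd_apply_of_order_le {L : ReflOp} {n : ℕ} (hL : L.order ≤ n) (F : Jet) (t : ℝ) :
    L.toEnd F 0 t = ∑ i ∈ Finset.range (n + 1),
      (L.refl.coeff i * F i (-t) + L.plain.coeff i * F i t) := by
  obtain ⟨hrefl, hplain⟩ := order_le_iff.1 hL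
  simp only [toEnd_apply, aeval_shift_apply_of_le hrefl, aeval_shift_apply_of_le hplain, pow_zero,
    one_mul, zero_add, Finset.sum_add_distrib]

lemma toEnd_congr {L : ReflOp} {n : ℕ} (hL : L.order ≤ n) {F G : Jet} {t : ℝ}
    (h' : ∀ k ≤ n, F k (-t) = G k (-t)) (h : ∀ k ≤ n, F k t = G k t) :
    L.toEnd F 0 t = L.toEnd G 0 t := by
  rw [toEnd_apply_of_order_le hL, toEnd_apply_of_order_le hL]
  exact Finset.sum_congr rfl fun i hi => by
    rw [h' i (Finset.mem_range_succ_iff.1 hi), h i (Finset.mem_range_succ_iff.1 hi)]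

lemma toEnd_ofPoly (S : ℝ[X]) : (ofPoly S).toEnd = aeval shift S := by
  simp [toEnd, ofPoly]

lemma mul_refl (A B : ReflOp) :
    (A * B).refl = A.refl * B.plain + A.plain.comp (-Polynomial.X) * B.refl := rfl

lemma mul_plain (A B : ReflOp) :
    (A * B).plain = A.refl.comp (-Polynomial.X) * B.refl + A.plain * B.plain := rfl

lemma toEnd_mul (A B : ReflOp) : (A * B).toEnd = A.toEnd * B.toEnd := by
  have refl_refl : reflect * aeval shift A.refl * (reflect * aeval shift B.refl)
      = aeval shift (A.refl.comp (-Polynomial.X)) * aeval shift B.refl := by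
    rw [mul_assoc, ← mul_assoc _ reflect, aeval_shift_mul_reflect, mul_assoc reflect,
      ← mul_assoc reflect, reflect_mul_reflect, one_mul]
  have plain_refl : aeval shift A.plain * (reflect * aeval shift B.refl)
      = reflect * (aeval shift (A.plain.comp (-Polynomial.X)) * aeval shift B.refl) := by
    rw [← mul_assoc, aeval_shift_mul_reflect, mul_assoc]
  simp only [toEnd, mul_refl, mul_plain, map_add, map_mul, mul_add, add_mul, refl_refl, plain_refl,
    mul_assoc]
  abel

/-- The reducing operator `R = φ* P(D) - Q(-D)` of `L = φ* P(D) + Q(D)`. -/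
def reducer (L : ReflOp) : ReflOp where
  refl := L.refl
  plain := -L.plain.comp (-Polynomial.X)

/-- The reduced operator `RL = P(-D) P(D) - Q(-D) Q(D)` of `L = φ* P(D) + Q(D)`. -/
def reduced (L : ReflOp) : ℝ[X] :=
  L.refl.comp (-Polynomial.X) * L.refl - L.plain.comp (-Polynomial.X) * L.plain

lemma coeff_comp_neg_X (P : ℝ[X]) (k : ℕ) :
    (P.comp (-Polynomial.X)).coeff k = (-1) ^ k * P.coeff k := by
  rw [show (-Polynomial.X : ℝ[X]) = Polynomial.C (-1) * Polynomial.X by simp,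
    Polynomial.comp_C_mul_X_coeff, mul_comm]

lemma natDegree_comp_neg_X (P : ℝ[X]) : (P.comp (-Polynomial.X)).natDegree = P.natDegree := by
  simp [Polynomial.natDegree_comp]

lemma order_reducer (L : ReflOp) : L.reducer.order = L.order := by
  simp only [order, reducer, Polynomial.natDegree_neg, natDegree_comp_neg_X]

lemma coeff_reducer_plain (L : ReflOp) (l : ℕ) :
    L.reducer.plain.coeff l = (-1) ^ (l + 1) * L.plain.coeff l := by
  rw [reducer, Polynomial.coeff_neg, coeff_comp_neg_X, pow_succ]
  ring

lemma reducer_mul (L : ReflOp) : L.reducer * L = ofPoly L.reduced := by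
  ext1
  · simp only [mul_refl, reducer, Polynomial.neg_comp, Polynomial.comp_neg_X_comp_neg_X, ofPoly]
    ring
  · simp only [mul_plain, reducer, reduced, ofPoly]
    ring

lemma mul_reducer (L : ReflOp) : L * L.reducer = ofPoly L.reduced := by
  ext1
  · simp only [mul_refl, reducer, ofPoly]
    ring
  · simp only [mul_plain, reducer, reduced, ofPoly]
    ring

lemma coeff_reduced {L : ReflOp} {n : ℕ} (hL : L.order ≤ n) :
    L.reduced.coeff (2 * n) = (-1) ^ n * (L.refl.coeff n ^ 2 - L.plain.coeff n ^ 2) := by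
  obtain ⟨hrefl, hplain⟩ := order_le_iff.1 hL
  rw [reduced, Polynomial.coeff_sub, two_mul,
    Polynomial.coeff_mul_add_eq_of_natDegree_le ((natDegree_comp_neg_X _).trans_le hrefl) hrefl,
    Polynomial.coeff_mul_add_eq_of_natDegree_le ((natDegree_comp_neg_X _).trans_le hplain) hplain,
    coeff_comp_neg_X, coeff_comp_neg_X]
  ring

lemma coeff_sq_sub_coeff_sq_ne_zero {L : ReflOp} {n : ℕ} (hn : n ≠ 0) (hL : L.order ≤ n)
    (hS : L.reduced.natDegree = 2 * n) : L.refl.coeff n ^ 2 - L.plain.coeff n ^ 2 ≠ 0 := by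
  have reduced_ne_zero : L.reduced ≠ 0 :=
    Polynomial.ne_zero_of_natDegree_gt (n := 0) (by omega)
  have := Polynomial.leadingCoeff_ne_zero.2 reduced_ne_zero
  rw [Polynomial.leadingCoeff, hS, coeff_reduced hL] at this
  exact right_ne_zero_of_mul this

end ReflOp

/-- On `I ∩ U` the jet `F` lists the derivatives within `I`, up to the order `N`, of `u`.
The set `U`, in practice open, localizes the statement without changing one-sided derivatives. -/
structure IsJet (N : ℕ) (I U : Set ℝ) (u : ℝ → ℝ) (F : Jet) : Prop where
  eqOn : ∀ t ∈ I ∩ U, u t = F 0 t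
  hasDeriv : ∀ k < N, ∀ t ∈ I ∩ U, HasDerivWithinAt (F k) (F (k + 1) t) I t

namespace IsJet

variable {N n : ℕ} {I U V : Set ℝ} {u : ℝ → ℝ} {F : Jet}

lemma mono (h : IsJet N I U u F) (hn : n ≤ N) (hV : V ⊆ U) : IsJet n I V u F where
  eqOn t ht := h.eqOn t ⟨ht.1, hV ht.2⟩
  hasDeriv k hk t ht := h.hasDeriv k (hk.trans_le hn) t ⟨ht.1, hV ht.2⟩

lemma iteratedDerivWithin_eq (h : IsJet N I U u F) (hI : UniqueDiffOn ℝ I) (hU : IsOpen U)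
    {k : ℕ} (hk : k ≤ N) {t : ℝ} (ht : t ∈ I ∩ U) : iteratedDerivWithin k u I t = F k t := by
  induction k generalizing t with
  | zero => simpa using h.eqOn t ht
  | succ k ih =>
    have eventually_eq : iteratedDerivWithin k u I =ᶠ[𝓝[I] t] F k := by
      filter_upwards [inter_mem self_mem_nhdsWithin
        (mem_nhdsWithin_of_mem_nhds (hU.mem_nhds ht.2))] with x hx
      exact ih (by omega) hx
    rw [iteratedDerivWithin_succ, eventually_eq.derivWithin_eq (ih (by omega) ht)]
    exact (h.hasDeriv k hk t ht).derivWithin (hI t ht.1)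

lemma contDiffOn (h : IsJet N I univ u F) (hI : UniqueDiffOn ℝ I)
    (hc : ContinuousOn (F N) I) : ContDiffOn ℝ N u I := by
  have eqOn (k : ℕ) (hk : k ≤ N) : EqOn (iteratedDerivWithin k u I) (F k) I :=
    fun t ht => h.iteratedDerivWithin_eq hI isOpen_univ hk ⟨ht, mem_univ t⟩
  rw [contDiffOn_nat_iff_continuousOn_differentiableOn_deriv hI]
  refine ⟨fun k hk => .congr ?_ (eqOn k hk), fun k hk => .congr ?_ (eqOn k hk.le)⟩
  · rcases hk.lt_or_eq with hk | rfl
    · exact fun t ht => (h.hasDeriv k hk t ⟨ht, mem_univ t⟩).continuousWithinAt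
    · exact hc
  · exact fun t ht => (h.hasDeriv k hk t ⟨ht, mem_univ t⟩).differentiableWithinAt

end IsJet

namespace Jet

variable {I : Set ℝ} {F : Jet} {k n : ℕ} {t : ℝ}

lemma hasDerivWithinAt_aeval_shift {P : ℝ[X]} (hP : P.natDegree ≤ n)
    (h : ∀ i ≤ n, HasDerivWithinAt (F (k + i)) (F (k + i + 1) t) I t) :
    HasDerivWithinAt (aeval shift P F k) (aeval shift P F (k + 1) t) I t := by
  rw [funext (aeval_shift_apply_of_le hP F k), aeval_shift_apply_of_le hP]
  refine HasDerivWithinAt.fun_sum fun i hi => ?_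
  rw [add_right_comm]
  exact (h i (Finset.mem_range_succ_iff.1 hi)).const_mul _

lemma hasDerivWithinAt_reflect (hI : ∀ t ∈ I, -t ∈ I)
    (h : HasDerivWithinAt (F k) (F (k + 1) (-t)) I (-t)) :
    HasDerivWithinAt (reflect F k) (reflect F (k + 1) t) I t := by
  have value : reflect F (k + 1) t = (-1) ^ k * (F (k + 1) (-t) * -1) := by
    rw [reflect_apply, pow_succ]
    ring
  rw [value]
  exact (HasDerivWithinAt.comp t h (hasDerivWithinAt_neg t I) hI).const_mul ((-1 : ℝ) ^ k)

lemma hasDerivWithinAt_toEnd {L : ReflOp} (hL : L.order ≤ n) (hI : ∀ t ∈ I, -t ∈ I)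
    (h : ∀ i ≤ n, HasDerivWithinAt (F (k + i)) (F (k + i + 1) t) I t)
    (h' : ∀ i ≤ n, HasDerivWithinAt (F (k + i)) (F (k + i + 1) (-t)) I (-t)) :
    HasDerivWithinAt (L.toEnd F k) (L.toEnd F (k + 1) t) I t :=
  have hL := ReflOp.order_le_iff.1 hL
  HasDerivWithinAt.add (hasDerivWithinAt_reflect hI (hasDerivWithinAt_aeval_shift hL.1 h'))
    (hasDerivWithinAt_aeval_shift hL.2 h)

end Jet

section Action

variable {N n : ℕ} {I J U : Set ℝ} {u : ℝ → ℝ} {F : Jet} {t : ℝ}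

lemma diffOp_eq_aeval_shift {P : ℝ[X]} (hP : P.natDegree ≤ n)
    (h : ∀ k ≤ n, iteratedDerivWithin k u J t = F k t) :
    diffOp P J u t = aeval shift P F 0 t := by
  rw [aeval_shift_apply_of_le hP, diffOp,
    Polynomial.sum_over_range' _ (by simp) _ (Nat.lt_succ_of_le hP)]
  refine Finset.sum_congr rfl fun i hi => ?_
  rw [h i (Finset.mem_range_succ_iff.1 hi), zero_add]

lemma act_eq_toEnd {L : ReflOp} (hL : L.order ≤ n)
    (h : ∀ k ≤ n, iteratedDerivWithin k u J t = F k t)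
    (h' : ∀ k ≤ n, iteratedDerivWithin k u J (-t) = F k (-t)) :
    L.act J u t = L.toEnd F 0 t := by
  have hL := ReflOp.order_le_iff.1 hL
  rw [ReflOp.act, ReflOp.toEnd_apply, diffOp_eq_aeval_shift hL.1 h',
    diffOp_eq_aeval_shift hL.2 h, pow_zero, one_mul]

lemma IsJet.act_eq_toEnd (h : IsJet n I U u F) {L : ReflOp} (hL : L.order ≤ n)
    (hI : UniqueDiffOn ℝ I) (hU : IsOpen U) (ht : t ∈ I ∩ U) (ht' : -t ∈ I ∩ U) :
    L.act I u t = L.toEnd F 0 t :=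
  ReflectionBVP.act_eq_toEnd hL (fun _ hk => h.iteratedDerivWithin_eq hI hU hk ht)
    fun _ hk => h.iteratedDerivWithin_eq hI hU hk ht'

lemma IsJet.act (h : IsJet (N + n) I U u F) {L : ReflOp} (hL : L.order ≤ n)
    (hI : UniqueDiffOn ℝ I) (hU : IsOpen U) (hI' : ∀ t ∈ I, -t ∈ I) (hU' : ∀ t ∈ U, -t ∈ U) :
    IsJet N I U (L.act I u) (L.toEnd F) where
  eqOn t ht := (h.mono (Nat.le_add_left n N) subset_rfl).act_eq_toEnd hL hI hU ht
    ⟨hI' t ht.1, hU' t ht.2⟩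
  hasDeriv k hk t ht := hasDerivWithinAt_toEnd hL hI'
    (fun i hi => h.hasDeriv (k + i) (by omega) t ht)
    (fun i hi => h.hasDeriv (k + i) (by omega) (-t) ⟨hI' t ht.1, hU' t ht.2⟩)

end Action

/-! ### Solutions of a linear equation with constant coefficients -/

section Uniqueness

variable {E : Type*} [NormedAddCommGroup E] [NormedSpace ℝ E] {J : Set ℝ} {t₀ t : ℝ} {K : ℝ}

lemma eq_zero_of_norm_deriv_le_of_le {x x' : ℝ → E} (hJ : J.OrdConnected)
    (hx : ∀ t ∈ J, HasDerivWithinAt x (x' t) J t) (hK : ∀ t ∈ J, ‖x' t‖ ≤ K * ‖x t‖)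
    (ht₀ : t₀ ∈ J) (hx₀ : x t₀ = 0) (ht : t ∈ J) (h : t₀ ≤ t) : x t = 0 := by
  have hsub : Icc t₀ t ⊆ J := hJ.out ht₀ ht
  refine eq_zero_of_abs_deriv_le_mul_abs_self_of_eq_zero_right (f' := x') (K := K)
    (fun s hs => (hx s (hsub hs)).continuousWithinAt.mono hsub) (fun s hs => ?_) hx₀
    (fun s hs => hK s (hsub (Ico_subset_Icc_self hs))) t (right_mem_Icc.2 h)
  exact ((hx s (hsub (Ico_subset_Icc_self hs))).mono hsub).mono_of_mem_nhdsWithin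
    (Icc_mem_nhdsGE_of_mem hs)

lemma eq_zero_of_norm_deriv_le {x x' : ℝ → E} (hJ : J.OrdConnected)
    (hx : ∀ t ∈ J, HasDerivWithinAt x (x' t) J t) (hK : ∀ t ∈ J, ‖x' t‖ ≤ K * ‖x t‖)
    (ht₀ : t₀ ∈ J) (hx₀ : x t₀ = 0) (ht : t ∈ J) : x t = 0 := by
  rcases le_total t₀ t with h | h
  · exact eq_zero_of_norm_deriv_le_of_le hJ hx hK ht₀ hx₀ ht h
  · have hneg : (Neg.neg ⁻¹' J).OrdConnected := hJ.preimage_anti fun _ _ => neg_le_neg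
    have hderiv : ∀ s ∈ Neg.neg ⁻¹' J,
        HasDerivWithinAt (fun s => x (-s)) (-x' (-s)) (Neg.neg ⁻¹' J) s := fun s hs => by
      have := (hx (-s) hs).scomp s (hasDerivWithinAt_neg s (Neg.neg ⁻¹' J)) fun _ h => h
      rwa [neg_one_smul] at this
    have := eq_zero_of_norm_deriv_le_of_le (t₀ := -t₀) (t := -t) hneg hderiv
      (fun s hs => by simpa using hK (-s) hs) (by simpa using ht₀) (by simpa using hx₀)
      (by simpa using ht) (neg_le_neg h)
    simpa using this

lemma eq_zero_of_norm_top_le {m : ℕ} {F : ℕ → ℝ → E} (hJ : J.OrdConnected)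
    (hF : ∀ k < m, ∀ t ∈ J, HasDerivWithinAt (F k) (F (k + 1) t) J t)
    (hK : ∀ t ∈ J, ‖F m t‖ ≤ K * ‖fun k : Fin m => F k t‖) (ht₀ : t₀ ∈ J)
    (hF₀ : ∀ k < m, F k t₀ = 0) (ht : t ∈ J) {k : ℕ} (hk : k ≤ m) : F k t = 0 := by
  have low : (fun k : Fin m => F k t) = 0 := by
    refine eq_zero_of_norm_deriv_le (x := fun t (k : Fin m) => F k t)
      (x' := fun t k => F (k + 1) t) (K := max 1 K) hJ
      (fun s hs => hasDerivWithinAt_pi.2 fun k => hF k k.2 s hs) (fun s hs => ?_) ht₀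
      (funext fun k => hF₀ k k.2) ht
    refine (pi_norm_le_iff_of_nonneg (by positivity)).2 fun k => ?_
    rcases (Nat.succ_le_of_lt k.2).lt_or_eq with hk | hk
    · exact (norm_le_pi_norm (fun k : Fin m => F k s) ⟨k + 1, hk⟩).trans
        (le_mul_of_one_le_left (norm_nonneg _) (le_max_left 1 K))
    · rw [show (k : ℕ) + 1 = m from hk]
      exact (hK s hs).trans (mul_le_mul_of_nonneg_right (le_max_right 1 K) (norm_nonneg _))
  rcases hk.lt_or_eq with hk | rfl
  · exact congrFun low ⟨k, hk⟩
  · simpa [low] using hK t ht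

end Uniqueness

namespace Jet

variable {S : ℝ[X]}

lemma top_eq_of_aeval_shift_eq_zero (hS : S ≠ 0) {F : Jet} {t : ℝ}
    (h : aeval shift S F 0 t = 0) :
    F S.natDegree t = ∑ k : Fin S.natDegree, -(S.coeff k / S.leadingCoeff) * F k t := by
  have hc : S.leadingCoeff ≠ 0 := Polynomial.leadingCoeff_ne_zero.2 hS
  rw [aeval_shift_apply_of_le le_rfl, Finset.sum_range_succ, ← Fin.sum_univ_eq_sum_range
    (fun k => S.coeff k * F (0 + k) t), Polynomial.coeff_natDegree] at h
  simp only [zero_add] at h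
  simp only [neg_mul, div_mul_eq_mul_div, Finset.sum_neg_distrib, ← Finset.sum_div]
  field_simp
  linear_combination h

lemma abs_sum_mul_le {m : ℕ} (c x : Fin m → ℝ) : |∑ k, c k * x k| ≤ (∑ k, |c k|) * ‖x‖ := by
  rw [Finset.sum_mul]
  refine (Finset.abs_sum_le_sum_abs _ _).trans (Finset.sum_le_sum fun k _ => ?_)
  rw [abs_mul]
  exact mul_le_mul_of_nonneg_left (norm_le_pi_norm x k) (abs_nonneg _)

theorem eq_zero_of_aeval_shift_eq_zero (hS : S ≠ 0) {J : Set ℝ} (hJ : J.OrdConnected) {F : Jet}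
    (hF : ∀ k < S.natDegree, ∀ t ∈ J, HasDerivWithinAt (F k) (F (k + 1) t) J t)
    (hSF : ∀ t ∈ J, aeval shift S F 0 t = 0) {t₀ : ℝ} (ht₀ : t₀ ∈ J)
    (hF₀ : ∀ k < S.natDegree, F k t₀ = 0) {t : ℝ} (ht : t ∈ J) {k : ℕ} (hk : k ≤ S.natDegree) :
    F k t = 0 :=
  eq_zero_of_norm_top_le hJ hF (fun s hs => by
    rw [top_eq_of_aeval_shift_eq_zero hS (hSF s hs)]
    exact abs_sum_mul_le _ _) ht₀ hF₀ ht hk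

/-- The first `m` entries of a jet at `a`. -/
def data (m : ℕ) (a : ℝ) : Jet →ₗ[ℝ] (Fin m → ℝ) where
  toFun F k := F k a
  map_add' _ _ := rfl
  map_smul' _ _ := rfl

/-- The jets of the solutions of `S u = 0` on the line. -/
def Sol (S : ℝ[X]) : Submodule ℝ Jet where
  carrier := {F | (∀ k t, HasDerivAt (F k) (F (k + 1) t) t) ∧ aeval shift S F = 0}
  add_mem' := by
    rintro F G ⟨hF, hSF⟩ ⟨hG, hSG⟩
    exact ⟨fun k t => (hF k t).add (hG k t), by rw [map_add, hSF, hSG, add_zero]⟩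
  zero_mem' := ⟨fun _ t => hasDerivAt_const t 0, map_zero _⟩
  smul_mem' := by
    rintro c F ⟨hF, hSF⟩
    exact ⟨fun k t => (hF k t).const_mul c, by rw [map_smul, hSF, smul_zero]⟩

namespace Sol

variable {F G : Jet}

lemma isJet (hF : F ∈ Sol S) (N : ℕ) {I U : Set ℝ} {u : ℝ → ℝ} (hu : ∀ t ∈ I ∩ U, u t = F 0 t) :
    IsJet N I U u F where
  eqOn := hu
  hasDeriv k _ t _ := (hF.1 k t).hasDerivWithinAt

lemma continuous (hF : F ∈ Sol S) (k : ℕ) : Continuous (F k) :=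
  continuous_iff_continuousAt.2 fun t => (hF.1 k t).continuousAt

lemma aeval_eq_zero (hF : F ∈ Sol S) (k : ℕ) (t : ℝ) : aeval shift S F k t = 0 := by
  rw [hF.2]; rfl

lemma translate_mem (hF : F ∈ Sol S) (a : ℝ) : translate a F ∈ Sol S := by
  refine ⟨fun k t => (hF.1 k (t - a)).comp_sub_const t a, ?_⟩
  ext k t
  have := aeval_eq_zero hF k (t - a)
  rw [aeval_shift_apply] at this ⊢
  exact this

lemma ext_zero (hF : F ∈ Sol S) (hG : G ∈ Sol S) (h : F 0 = G 0) : F = G := by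
  funext k
  induction k with
  | zero => exact h
  | succ k ih => exact funext fun t => (hF.1 k t).unique (ih ▸ hG.1 k t)

theorem eq_zero_of_data_eq_zero (hS : S ≠ 0) (hF : F ∈ Sol S) (a : ℝ)
    (h : ∀ k < S.natDegree, F k a = 0) : F = 0 :=
  ext_zero hF (Submodule.zero_mem _) <| funext fun t =>
    eq_zero_of_aeval_shift_eq_zero hS ordConnected_univ
      (fun k _ t _ => (hF.1 k t).hasDerivWithinAt) (fun t _ => aeval_eq_zero hF 0 t)
      (mem_univ a) h (mem_univ t) (Nat.zero_le _)

theorem eq_zero_of_Icc (hS : S ≠ 0) (hF : F ∈ Sol S) {a b : ℝ} (hab : a < b)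
    (h : ∀ t ∈ Icc a b, F 0 t = 0) : F = 0 := by
  refine eq_zero_of_data_eq_zero hS hF a fun k _ => ?_
  have := (isJet hF k (U := univ) (u := fun _ => 0) fun t ht => (h t ht.1).symm)
    |>.iteratedDerivWithin_eq (uniqueDiffOn_Icc hab) isOpen_univ le_rfl
      ⟨left_mem_Icc.2 hab.le, mem_univ a⟩
  rw [← this, iteratedDerivWithin_fun_const_zero]

lemma exp_mem {V : Type*} [NormedAddCommGroup V] [NormedSpace ℝ V] [CompleteSpace V]
    {A : V →L[ℝ] V} (hA : aeval A S = 0) (ℓ : V →L[ℝ] ℝ) (v : V) :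
    (fun k t => ℓ ((A ^ k * NormedSpace.exp (t • A)) v)) ∈ Sol S := by
  refine ⟨fun k t => ?_, ?_⟩
  · have hexp := ((hasDerivAt_exp_smul_const' A t).const_mul (A ^ k)).clm_apply
      (hasDerivAt_const t v)
    rw [← mul_assoc, ← pow_succ, map_zero, add_zero] at hexp
    exact ℓ.hasFDerivAt.comp_hasDerivAt t hexp
  · ext k t
    have : ℓ ((aeval A S * (A ^ k * NormedSpace.exp (t • A))) v) = 0 := by simp [hA]
    rw [aeval_shift_apply_of_le le_rfl]
    rw [Polynomial.aeval_eq_sum_range, Finset.sum_mul] at this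
    simpa [add_comm k, pow_add, mul_assoc] using this

theorem exists_data_eq (hS : S ≠ 0) (x : Fin S.natDegree → ℝ) :
    ∃ F ∈ Sol S, ∀ k : Fin S.natDegree, F k 0 = x k := by
  let b := AdjoinRoot.powerBasisAux hS
  let φ : AdjoinRoot S →ₐ[ℝ] ((Fin S.natDegree → ℝ) →L[ℝ] (Fin S.natDegree → ℝ)) :=
    (Module.End.toContinuousLinearMap _).toAlgHom.comp
      (Matrix.toLinAlgEquiv'.toAlgHom.comp (Algebra.leftMulMatrix b))
  have hφ (y z : AdjoinRoot S) : φ y (b.repr z) = b.repr (y * z) :=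
    Algebra.leftMulMatrix_mulVec_repr b y z
  have aeval_root : aeval (φ (AdjoinRoot.root S)) S = 0 := by
    rw [Polynomial.aeval_algHom_apply, AdjoinRoot.aeval_eq, AdjoinRoot.mk_self, map_zero]
  have root_pow (k : Fin S.natDegree) :
      b.repr (AdjoinRoot.root S ^ (k : ℕ)) = Finsupp.single k 1 := by
    rw [← b.repr_self k]
    exact congrArg b.repr ((AdjoinRoot.powerBasis hS).basis_eq_pow k).symm
  let ℓ : (Fin S.natDegree → ℝ) →L[ℝ] ℝ := ∑ k, x k • ContinuousLinearMap.proj k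
  refine ⟨_, exp_mem aeval_root ℓ (b.repr 1), fun k => ?_⟩
  have power : (φ (AdjoinRoot.root S) ^ (k : ℕ)) (b.repr 1) = Finsupp.single k 1 := by
    rw [← map_pow, hφ, mul_one, root_pow]
  simp [power, ℓ, Finsupp.single_apply]

/-- A solution of `S u = 0` on the line amounts to its data at a point `a`. -/
def dataEquiv (hS : S ≠ 0) (a : ℝ) : Sol S ≃ₗ[ℝ] (Fin S.natDegree → ℝ) :=
  LinearEquiv.ofBijective (data S.natDegree a ∘ₗ (Sol S).subtype) <| by
    refine ⟨(injective_iff_map_eq_zero _).2 fun F hF => Subtype.ext ?_, fun x => ?_⟩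
    · exact eq_zero_of_data_eq_zero hS F.2 a fun k hk => congrFun hF ⟨k, hk⟩
    · obtain ⟨F, hF, h⟩ := exists_data_eq hS x
      exact ⟨⟨translate a F, translate_mem hF a⟩, funext fun k => by simpa [data] using h k⟩

/-- The solution of `S u = 0` on the line with prescribed data at `a`. -/
def ofData (hS : S ≠ 0) (a : ℝ) : (Fin S.natDegree → ℝ) →ₗ[ℝ] Jet :=
  (Sol S).subtype ∘ₗ (dataEquiv hS a).symm.toLinearMap

lemma ofData_mem (hS : S ≠ 0) (a : ℝ) (x : Fin S.natDegree → ℝ) : ofData hS a x ∈ Sol S :=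
  ((dataEquiv hS a).symm x).2

lemma ofData_apply_self (hS : S ≠ 0) (a : ℝ) (x : Fin S.natDegree → ℝ) (k : Fin S.natDegree) :
    ofData hS a x k a = x k :=
  congrFun ((dataEquiv hS a).apply_symm_apply x) k

lemma ofData_self (hS : S ≠ 0) (a : ℝ) (hF : F ∈ Sol S) : ofData hS a (fun k => F k a) = F :=
  congrArg Subtype.val ((dataEquiv hS a).symm_apply_apply ⟨F, hF⟩)

end Sol

/-- `g` is the jet of the fundamental solution of `S u = 0`: the solution on the line with
`u^(k)(0) = 0` for `k + 1 < m` and `u^(m-1)(0) = 1 / c_m`. -/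
structure IsFundamental (S : ℝ[X]) (g : Jet) : Prop where
  mem : g ∈ Sol S
  low : ∀ k, k + 1 < S.natDegree → g k 0 = 0
  top : ∀ k, k + 1 = S.natDegree → g k 0 = 1 / S.leadingCoeff

lemma exists_isFundamental (hS : S ≠ 0) : ∃ g, IsFundamental S g := by
  let x : Fin S.natDegree → ℝ := fun k => if k + 1 = S.natDegree then 1 / S.leadingCoeff else 0
  have apply_zero (k : Fin S.natDegree) : Sol.ofData hS 0 x k 0 = x k :=
    Sol.ofData_apply_self hS 0 x k
  refine ⟨Sol.ofData hS 0 x, Sol.ofData_mem hS 0 x, fun k hk => ?_, fun k hk => ?_⟩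
  · exact (apply_zero ⟨k, by omega⟩).trans (if_neg hk.ne)
  · exact (apply_zero ⟨k, by omega⟩).trans (if_pos hk)

/-- The solutions `v j` of `S u = 0` form a basis, and the functionals `Λ i` are the coordinates
in it. -/
structure IsDualBasis {ι : Type*} [Fintype ι] [DecidableEq ι] (S : ℝ[X]) (Λ : ι → Jet →ₗ[ℝ] ℝ)
    (v : ι → Jet) : Prop where
  mem : ∀ j, v j ∈ Sol S
  apply_eq : ∀ i j, Λ i (v j) = if i = j then 1 else 0
  sum_smul_eq : ∀ F ∈ Sol S, ∑ i, Λ i F • v i = F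

section DualBasis

variable {ι : Type*} [Fintype ι] [DecidableEq ι] {Λ : ι → Jet →ₗ[ℝ] ℝ} {v : ι → Jet}

lemma IsDualBasis.sum_smul_mem (hv : IsDualBasis S Λ v) (c : ι → ℝ) : ∑ i, c i • v i ∈ Sol S :=
  Submodule.sum_mem _ fun i _ => Submodule.smul_mem _ _ (hv.mem i)

lemma IsDualBasis.apply_sum_smul (hv : IsDualBasis S Λ v) (c : ι → ℝ) (i : ι) :
    Λ i (∑ j, c j • v j) = c i := by
  simp [hv.apply_eq]

theorem exists_isDualBasis (hS : S ≠ 0) (hι : Fintype.card ι = S.natDegree)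
    (hΛ : ∀ F ∈ Sol S, (∀ i, Λ i F = 0) → F = 0) : ∃ v, IsDualBasis S Λ v := by
  let f : Sol S →ₗ[ℝ] (ι → ℝ) := LinearMap.pi fun i => Λ i ∘ₗ (Sol S).subtype
  have hf : Function.Injective f := (injective_iff_map_eq_zero f).2 fun F hF =>
    Subtype.ext (hΛ F F.2 fun i => congrFun hF i)
  have : FiniteDimensional ℝ (Sol S) := (Sol.dataEquiv hS 0).symm.finiteDimensional
  have finrank_eq : Module.finrank ℝ (Sol S) = Module.finrank ℝ (ι → ℝ) := by
    rw [(Sol.dataEquiv hS 0).finrank_eq, Module.finrank_fin_fun, Module.finrank_pi, hι]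
  choose v hv using fun j =>
    (LinearMap.injective_iff_surjective_of_finrank_eq_finrank finrank_eq).1 hf (Pi.single j 1)
  have apply_eq (i j : ι) : Λ i (v j) = if i = j then 1 else 0 := by
    rw [← Pi.single_apply, ← hv j]
    rfl
  refine ⟨fun j => v j, fun j => (v j).2, apply_eq, fun F hF => sub_eq_zero.1 (hΛ _ ?_ fun i => ?_)⟩
  · exact Submodule.sub_mem _
      (Submodule.sum_mem _ fun i _ => Submodule.smul_mem _ _ (v i).2) hF
  · simp [apply_eq]

end DualBasis

end Jet

/-! ### Absolutely continuous jets -/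

lemma neg_mem_Icc_neg {T t : ℝ} (ht : t ∈ Icc (-T) T) : -t ∈ Icc (-T) T :=
  ⟨neg_le_neg ht.2, neg_le.1 ht.1⟩

lemma ae_restrict_Icc_neg {T : ℝ} {p : ℝ → Prop}
    (h : ∀ᵐ t ∂(volume.restrict (Icc (-T) T)), p t) :
    ∀ᵐ t ∂(volume.restrict (Icc (-T) T)), p (-t) := by
  rw [ae_restrict_iff' measurableSet_Icc] at h ⊢
  filter_upwards [(Measure.measurePreserving_neg (volume : Measure ℝ)).quasiMeasurePreserving.ae h]
    with t ht hmem using ht (neg_mem_Icc_neg hmem)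

lemma ae_restrict_Icc_mem_nhds (a b : ℝ) :
    ∀ᵐ t ∂(volume.restrict (Icc a b)), Icc a b ∈ 𝓝 t := by
  filter_upwards [ae_restrict_mem measurableSet_Icc,
    ae_restrict_of_ae (Measure.ae_ne volume a), ae_restrict_of_ae (Measure.ae_ne volume b)]
    with t ht ha hb using Icc_mem_nhds (ht.1.lt_of_ne' ha) (ht.2.lt_of_ne hb)

section AbsolutelyContinuous

variable {f g : ℝ → ℝ} {a b : ℝ}

lemma absolutelyContinuousOnInterval_congr (hf : AbsolutelyContinuousOnInterval f a b)
    (h : EqOn f g (uIcc a b)) : AbsolutelyContinuousOnInterval g a b := by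
  rw [absolutelyContinuousOnInterval_iff] at hf ⊢
  intro ε hε
  obtain ⟨δ, hδ, H⟩ := hf ε hε
  refine ⟨δ, hδ, fun E hE hlt => (Finset.sum_congr rfl fun i hi => ?_).trans_lt (H E hE hlt)⟩
  rw [h (hE.1 i hi).1, h (hE.1 i hi).2]

lemma absolutelyContinuousOnInterval_const (c : ℝ) :
    AbsolutelyContinuousOnInterval (fun _ => c) a b :=
  ContDiffOn.absolutelyContinuousOnInterval contDiffOn_const

lemma absolutelyContinuousOnInterval_sum {ι : Type*} {f : ι → ℝ → ℝ} (s : Finset ι)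
    (hf : ∀ i ∈ s, AbsolutelyContinuousOnInterval (f i) a b) :
    AbsolutelyContinuousOnInterval (∑ i ∈ s, f i) a b :=
  Finset.sum_induction _ (AbsolutelyContinuousOnInterval · a b) (fun _ _ hf hg => hf.add hg)
    (absolutelyContinuousOnInterval_const 0) hf

-- `f (-t) = f b - ∫ s in -b..t, f' (-s)`
lemma absolutelyContinuousOnInterval_comp_neg (hf : AbsolutelyContinuousOnInterval f a b) :
    AbsolutelyContinuousOnInterval (fun t => f (-t)) (-a) (-b) := by
  have deriv_integrable : IntervalIntegrable (fun s => deriv f (-s)) volume (-a) (-b) :=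
    (IntervalIntegrable.iff_comp_neg (by simp)).1 hf.intervalIntegrable_deriv
  refine absolutelyContinuousOnInterval_congr
    ((absolutelyContinuousOnInterval_const (f b)).fun_sub
      (deriv_integrable.absolutelyContinuousOnInterval_intervalIntegral right_mem_uIcc))
    fun t ht => ?_
  rw [← image_neg_uIcc] at ht
  obtain ⟨x, hx, rfl⟩ := ht
  rw [intervalIntegral.integral_comp_neg, neg_neg, neg_neg,
    (hf.mono (uIcc_subset_uIcc hx right_mem_uIcc)).integral_deriv_eq_sub]
  ring

end AbsolutelyContinuous

namespace Jet

/-- The jets of the functions of `W^{n,1}([-T, T])`: the entries of index less than `n` are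
absolutely continuous, with the next entry as derivative almost everywhere. -/
def ACJet (T : ℝ) (n : ℕ) : Submodule ℝ Jet where
  carrier := {F | ∀ k < n, AbsolutelyContinuousOnInterval (F k) (-T) T ∧
    ∀ᵐ t ∂(volume.restrict (Icc (-T) T)), HasDerivAt (F k) (F (k + 1) t) t}
  add_mem' := by
    intro F G hF hG k hk
    refine ⟨(hF k hk).1.add (hG k hk).1, ?_⟩
    filter_upwards [(hF k hk).2, (hG k hk).2] with t hFt hGt using hFt.add hGt
  zero_mem' := fun k _ => ⟨absolutelyContinuousOnInterval_const 0,
    Eventually.of_forall fun t => hasDerivAt_const t 0⟩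
  smul_mem' := by
    intro c F hF k hk
    refine ⟨(hF k hk).1.const_mul c, ?_⟩
    filter_upwards [(hF k hk).2] with t hFt using hFt.const_mul c

lemma Sol.mem_ACJet {S : ℝ[X]} {F : Jet} (hF : F ∈ Sol S) (T : ℝ) (n : ℕ) : F ∈ ACJet T n := by
  refine fun k _ => ⟨ContDiffOn.absolutelyContinuousOnInterval (ContDiff.contDiffOn ?_),
    Eventually.of_forall fun t => hF.1 k t⟩
  rw [contDiff_one_iff_deriv, funext fun t => (hF.1 k t).deriv]
  exact ⟨fun t => (hF.1 k t).differentiableAt, Sol.continuous hF (k + 1)⟩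

namespace ACJet

variable {T : ℝ} {N n : ℕ} {F : Jet}

lemma aeval_shift_mem {P : ℝ[X]} {r : ℕ} (hP : P.natDegree ≤ r) (hF : F ∈ ACJet T (n + r)) :
    aeval shift P F ∈ ACJet T n := by
  rw [Polynomial.aeval_eq_sum_range, LinearMap.sum_apply]
  refine Submodule.sum_mem _ fun i hi => Submodule.smul_mem _ _ fun k hk => ?_
  have shift_pow (k : ℕ) : (shift ^ i) F k = F (k + i) := funext (shift_pow_apply i F k)
  rw [shift_pow, shift_pow, add_right_comm]
  exact hF (k + i) (by have := Finset.mem_range.1 hi; omega)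

lemma reflect_mem (hF : F ∈ ACJet T n) : reflect F ∈ ACJet T n := by
  refine fun k hk => ⟨?_, ?_⟩
  · have := absolutelyContinuousOnInterval_comp_neg (hF k hk).1.symm
    rw [neg_neg] at this
    exact this.const_mul _
  · filter_upwards [ae_restrict_Icc_neg (hF k hk).2] with t ht
    exact hasDerivWithinAt_univ.1
      (hasDerivWithinAt_reflect (fun _ _ => mem_univ _) ht.hasDerivWithinAt)

lemma toEnd_mem {L : ReflOp} {r : ℕ} (hL : L.order ≤ r) (hF : F ∈ ACJet T (n + r)) :
    L.toEnd F ∈ ACJet T n :=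
  have hL := ReflOp.order_le_iff.1 hL
  Submodule.add_mem _ (reflect_mem (aeval_shift_mem hL.1 hF)) (aeval_shift_mem hL.2 hF)

variable (hT : 0 < T)
include hT

lemma continuousOn (hF : F ∈ ACJet T n) {k : ℕ} (hk : k < n) :
    ContinuousOn (F k) (Icc (-T) T) := by
  have := (hF k hk).1.continuousOn
  rwa [uIcc_of_le (by linarith)] at this

lemma integral_eq (hF : F ∈ ACJet T n) {k : ℕ} (hk : k < n) {s t : ℝ}
    (hs : s ∈ Icc (-T) T) (ht : t ∈ Icc (-T) T) : ∫ x in s..t, F (k + 1) x = F k t - F k s := by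
  have hsub : uIcc s t ⊆ Icc (-T) T := ordConnected_Icc.uIcc_subset hs ht
  rw [← ((hF k hk).1.mono (c := s) (d := t)
    (by rwa [uIcc_of_le (by linarith : -T ≤ T)])).integral_deriv_eq_sub]
  refine intervalIntegral.integral_congr_ae ?_
  filter_upwards [(ae_restrict_iff' measurableSet_Icc).1 (hF k hk).2] with x hx hxs
  exact (hx (hsub (uIoc_subset_uIcc hxs))).deriv.symm

lemma hasDerivWithinAt (hF : F ∈ ACJet T n) {k : ℕ} (hk : k < n)
    (hc : ContinuousOn (F (k + 1)) (Icc (-T) T)) {t : ℝ} (ht : t ∈ Icc (-T) T) :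
    HasDerivWithinAt (F k) (F (k + 1) t) (Icc (-T) T) t := by
  have hle : -T ≤ T := by linarith
  have hleft := left_mem_Icc.2 hle
  set φ : ℝ → ℝ := IccExtend hle ((Icc (-T) T).domRestrict (F (k + 1)))
  have φ_continuous : Continuous φ := (continuousOn_iff_continuous_domRestrict.1 hc).Icc_extend'
  have φ_eq : EqOn φ (F (k + 1)) (Icc (-T) T) := fun x hx => IccExtend_of_mem hle _ hx
  have primitive : ∀ x ∈ Icc (-T) T, F k x = F k (-T) + ∫ y in (-T)..x, φ y := fun x hx => by
    rw [intervalIntegral.integral_congr (φ_eq.mono (ordConnected_Icc.uIcc_subset hleft hx)),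
      integral_eq hT hF hk hleft hx, add_sub_cancel]
  rw [← φ_eq ht]
  exact ((φ_continuous.integral_hasStrictDerivAt (-T) t).hasDerivAt.const_add _).hasDerivWithinAt
    |>.congr primitive (primitive t ht)

lemma isJet (hF : F ∈ ACJet T n) (hN : N < n) {U : Set ℝ} {u : ℝ → ℝ}
    (hu : ∀ t ∈ Icc (-T) T, u t = F 0 t) : IsJet N (Icc (-T) T) U u F where
  eqOn t ht := hu t ht.1
  hasDeriv _ hk _ ht :=
    hasDerivWithinAt hT hF (by omega) (continuousOn hT hF (by omega)) ht.1

lemma iteratedDerivWithin_eq (hF : F ∈ ACJet T n) {u : ℝ → ℝ}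
    (hu : ∀ t ∈ Icc (-T) T, u t = F 0 t) {k : ℕ} (hk : k < n) :
    EqOn (iteratedDerivWithin k u (Icc (-T) T)) (F k) (Icc (-T) T) := fun t ht =>
  (isJet hT hF hk hu).iteratedDerivWithin_eq (uniqueDiffOn_Icc (by linarith)) isOpen_univ le_rfl
    ⟨ht, mem_univ t⟩

lemma ae_iteratedDerivWithin_eq (hF : F ∈ ACJet T n) {u : ℝ → ℝ}
    (hu : ∀ t ∈ Icc (-T) T, u t = F 0 t) :
    ∀ᵐ t ∂(volume.restrict (Icc (-T) T)), ∀ k ≤ n,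
      iteratedDerivWithin k u (Icc (-T) T) t = F k t := by
  rcases n with _ | n
  · filter_upwards [ae_restrict_mem measurableSet_Icc] with t ht k hk
    rw [Nat.le_zero.1 hk, iteratedDerivWithin_zero, hu t ht]
  · filter_upwards [ae_restrict_mem measurableSet_Icc, (hF n n.lt_succ_self).2] with t ht hd k hk
    rcases hk.lt_or_eq with hk | rfl
    · exact iteratedDerivWithin_eq hT hF hu hk ht
    · have eqOn := iteratedDerivWithin_eq hT hF hu n.lt_succ_self
      rw [iteratedDerivWithin_succ, derivWithin_congr eqOn (eqOn ht)]
      exact hd.hasDerivWithinAt.derivWithin (uniqueDiffOn_Icc (by linarith) t ht)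

lemma ae_act_eq_toEnd {L : ReflOp} (hL : L.order ≤ n) (hF : F ∈ ACJet T n) {u : ℝ → ℝ}
    (hu : ∀ t ∈ Icc (-T) T, u t = F 0 t) :
    ∀ᵐ t ∂(volume.restrict (Icc (-T) T)), L.act (Icc (-T) T) u t = L.toEnd F 0 t := by
  have hae := ae_iteratedDerivWithin_eq hT hF hu
  filter_upwards [hae, ae_restrict_Icc_neg hae] with t h h' using act_eq_toEnd hL h h'

lemma isSobolev (hF : F ∈ ACJet T n) {u : ℝ → ℝ} (hu : ∀ t ∈ Icc (-T) T, u t = F 0 t) :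
    IsSobolev T n u := fun k hk =>
  ⟨(isJet hT hF hk hu).contDiffOn (uniqueDiffOn_Icc (by linarith)) (continuousOn hT hF hk),
    absolutelyContinuousOnInterval_congr (hF k hk).1 <| by
      rw [uIcc_of_le (by linarith)]
      exact (iteratedDerivWithin_eq hT hF hu hk).symm⟩

end ACJet

end Jet

/-- The jet of the derivatives of `u` within `[-T, T]`. -/
def jetOf (T : ℝ) (u : ℝ → ℝ) : Jet := fun k => iteratedDerivWithin k u (Icc (-T) T)

lemma jetOf_zero (T : ℝ) (u : ℝ → ℝ) : jetOf T u 0 = u := iteratedDerivWithin_zero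

lemma IsSobolev.jetOf_mem_ACJet {T : ℝ} (hT : 0 < T) {n : ℕ} {u : ℝ → ℝ} (h : IsSobolev T n u) :
    jetOf T u ∈ ACJet T n := by
  refine fun k hk => ⟨(h k hk).2, ?_⟩
  filter_upwards [ae_restrict_of_ae (h k hk).2.ae_differentiableAt,
    ae_restrict_Icc_mem_nhds (-T) T] with t ht hnhds
  rw [uIcc_of_le (by linarith)] at ht
  simp only [jetOf, iteratedDerivWithin_succ, derivWithin_of_mem_nhds hnhds]
  exact (ht (mem_of_mem_nhds hnhds)).hasDerivAt

/-! ### Uniqueness of solutions with given data for operators with reflection -/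

section ReflectionUniqueness

variable {L : ReflOp} {n : ℕ}

-- `a_n (LF)(-t) - b_n (LF)(t)` contains `F_n(t)` with the factor `a_n ^ 2 - b_n ^ 2` and is free
-- of `F_n(-t)`.
lemma exists_top_eq_of_toEnd_eq_zero (hL : L.order ≤ n)
    (hd : L.refl.coeff n ^ 2 - L.plain.coeff n ^ 2 ≠ 0) :
    ∃ p q : Fin n → ℝ, ∀ (F : Jet) (t : ℝ), L.toEnd F 0 t = 0 → L.toEnd F 0 (-t) = 0 →
      F n t = ∑ k, (p k * F k t + q k * F k (-t)) := by
  set a := L.refl.coeff with ha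
  set b := L.plain.coeff with hb
  set d := a n ^ 2 - b n ^ 2
  obtain ⟨hrefl, hplain⟩ := ReflOp.order_le_iff.1 hL
  refine ⟨fun k => (b n * b k - a n * a k) / d, fun k => (b n * a k - a n * b k) / d,
    fun F t h h' => ?_⟩
  simp only [ReflOp.toEnd_apply, aeval_shift_apply_of_le hrefl, aeval_shift_apply_of_le hplain,
    Finset.sum_range_succ, pow_zero, one_mul, zero_add, neg_neg, ← ha, ← hb] at h h'
  have combination : d * F n t = ∑ k ∈ Finset.range n,
      ((b n * b k - a n * a k) * F k t + (b n * a k - a n * b k) * F k (-t)) := by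
    simp only [sub_mul, mul_assoc, Finset.sum_add_distrib, Finset.sum_sub_distrib,
      ← Finset.mul_sum]
    linear_combination a n * h' - b n * h
  rw [← mul_right_inj' hd, combination, ← Fin.sum_univ_eq_sum_range
    (fun k => (b n * b k - a n * a k) * F k t + (b n * a k - a n * b k) * F k (-t)),
    Finset.mul_sum]
  refine Finset.sum_congr rfl fun k _ => ?_
  field_simp

lemma abs_sum_add_le (p q x y : Fin n → ℝ) {M : ℝ} (hx : ∀ k, |x k| ≤ M) (hy : ∀ k, |y k| ≤ M) :
    |∑ k, (p k * x k + q k * y k)| ≤ (∑ k, (|p k| + |q k|)) * M := by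
  rw [Finset.sum_mul]
  refine (Finset.abs_sum_le_sum_abs _ _).trans (Finset.sum_le_sum fun k _ => ?_)
  calc |p k * x k + q k * y k| ≤ |p k| * |x k| + |q k| * |y k| := by
        simpa only [abs_mul] using abs_add_le (p k * x k) (q k * y k)
    _ ≤ |p k| * M + |q k| * M := by gcongr <;> [exact hx k; exact hy k]
    _ = (|p k| + |q k|) * M := (add_mul _ _ _).symm

lemma eq_zero_of_top_eq {F : Jet} {J : Set ℝ} (hJ : J.OrdConnected) (hJ' : ∀ t ∈ J, -t ∈ J)
    (h0 : 0 ∈ J) (hF : ∀ k < n, ∀ t ∈ J, HasDerivWithinAt (F k) (F (k + 1) t) J t)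
    (p q : Fin n → ℝ) (htop : ∀ t ∈ J, F n t = ∑ k, (p k * F k t + q k * F k (-t)))
    (hF₀ : ∀ k < n, F k 0 = 0) {k : ℕ} (hk : k < n) {t : ℝ} (ht : t ∈ J) : F k t = 0 := by
  -- The pair `(F(t), F(-t))` solves a differential equation without reflection.
  let H : ℕ → ℝ → ℝ × ℝ := fun k t => (F k t, reflect F k t)
  have abs_le (t : ℝ) (k : Fin n) : |F k t| ≤ ‖fun k : Fin n => H k t‖ :=
    (norm_fst_le (H k t)).trans (norm_le_pi_norm (fun k : Fin n => H k t) k)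
  have abs_neg_le (t : ℝ) (k : Fin n) : |F k (-t)| ≤ ‖fun k : Fin n => H k t‖ := by
    have := (norm_snd_le (H k t)).trans (norm_le_pi_norm (fun k : Fin n => H k t) k)
    simpa [H, abs_mul] using this
  refine congrArg Prod.fst (eq_zero_of_norm_top_le (F := H) hJ
    (fun k hk s hs => (hF k hk s hs).prodMk
      (hasDerivWithinAt_reflect hJ' (hF k hk (-s) (hJ' s hs))))
    (K := ∑ k, (|p k| + |q k|)) (fun s hs => ?_) h0 (fun k hk => ?_) ht hk.le)
  · refine max_le ?_ ?_
    · change |F n s| ≤ _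
      rw [htop s hs]
      exact abs_sum_add_le p q _ _ (abs_le s) (abs_neg_le s)
    · change ‖reflect F n s‖ ≤ _
      rw [reflect_apply, htop (-s) (hJ' s hs), neg_neg, norm_mul, norm_pow, norm_neg, norm_one,
        one_pow, one_mul]
      exact abs_sum_add_le p q _ _ (abs_neg_le s) (abs_le s)
  · simp [H, hF₀ k hk]

theorem Jet.ACJet.eq_zero_of_data_eq_zero {T : ℝ} (hT : 0 < T) (hL : L.order ≤ n)
    (hd : L.refl.coeff n ^ 2 - L.plain.coeff n ^ 2 ≠ 0) {F : Jet} (hF : F ∈ ACJet T n)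
    (hLF : ∀ᵐ t ∂(volume.restrict (Icc (-T) T)), L.toEnd F 0 t = 0)
    (hF₀ : ∀ k < n, F k 0 = 0) {k : ℕ} (hk : k < n) {t : ℝ} (ht : t ∈ Icc (-T) T) :
    F k t = 0 := by
  obtain ⟨p, q, htop⟩ := exists_top_eq_of_toEnd_eq_zero hL hd
  -- Correcting the top entry on a null set makes it continuous.
  let E : ℝ → ℝ := fun t => ∑ k : Fin n, (p k * F k t + q k * F k (-t))
  let G : Jet := Function.update F n E
  have G_low {k : ℕ} (hk : k < n) : G k = F k := Function.update_of_ne hk.ne _ _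
  have G_top : G n = E := Function.update_self _ _ _
  have G_ae : ∀ᵐ t ∂(volume.restrict (Icc (-T) T)), ∀ k ≤ n, G k t = F k t := by
    filter_upwards [hLF, ae_restrict_Icc_neg hLF] with t h h' k hk
    rcases hk.lt_or_eq with hk | rfl
    · rw [G_low hk]
    · rw [G_top, htop F t h h']
  have G_mem : G ∈ ACJet T n := fun k hk => by
    rw [G_low hk]
    refine ⟨(hF k hk).1, ?_⟩
    filter_upwards [(hF k hk).2, G_ae] with t hderiv hG
    rwa [hG (k + 1) hk]
  have E_continuousOn : ContinuousOn E (Icc (-T) T) :=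
    continuousOn_finsetSum _ fun k _ => (continuousOn_const.mul (continuousOn hT hF k.2)).add
      (continuousOn_const.mul ((continuousOn hT hF k.2).comp continuousOn_neg
        fun _ => neg_mem_Icc_neg))
  rw [← G_low hk]
  refine eq_zero_of_top_eq ordConnected_Icc (fun _ => neg_mem_Icc_neg)
    ⟨by linarith, hT.le⟩ (fun k hk s hs => hasDerivWithinAt hT G_mem hk ?_ hs) p q
    (fun s _ => ?_) (fun k hk => by rw [G_low hk, hF₀ k hk]) hk ht
  · rcases (Nat.succ_le_of_lt hk).lt_or_eq with hk | hk
    · exact continuousOn hT G_mem hk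
    · rwa [show k + 1 = n from hk, G_top]
  · rw [G_top]
    exact Finset.sum_congr rfl fun k _ => by rw [G_low k.2]

end ReflectionUniqueness

/-! ### Two-point functionals -/

namespace Jet

/-- Evaluation of the `k`-th entry at `t`. -/
def evalAt (k : ℕ) (t : ℝ) : Jet →ₗ[ℝ] ℝ where
  toFun F := F k t
  map_add' _ _ := rfl
  map_smul' _ _ := rfl

@[simp] lemma evalAt_apply (k : ℕ) (t : ℝ) (F : Jet) : evalAt k t F = F k t := rfl

/-- The linear functionals in the entries of index less than `m` at `-T` and `T`. -/
def TwoPoint (T : ℝ) (m : ℕ) : Submodule ℝ (Jet →ₗ[ℝ] ℝ) :=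
  Submodule.span ℝ (range fun k : Fin m => evalAt k (-T)) ⊔
    Submodule.span ℝ (range fun k : Fin m => evalAt k T)

variable {T : ℝ} {m n : ℕ}

namespace TwoPoint

lemma evalAt_mem {k : ℕ} (hk : k < m) {t : ℝ} (ht : t = -T ∨ t = T) :
    evalAt k t ∈ TwoPoint T m := by
  rcases ht with rfl | rfl
  · exact Submodule.mem_sup_left (Submodule.subset_span ⟨⟨k, hk⟩, rfl⟩)
  · exact Submodule.mem_sup_right (Submodule.subset_span ⟨⟨k, hk⟩, rfl⟩)

variable {l : Jet →ₗ[ℝ] ℝ}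

lemma exists_coeff (hl : l ∈ TwoPoint T m) :
    ∃ A B : Fin m → ℝ, ∀ F : Jet, l F = ∑ k, (A k * F k (-T) + B k * F k T) := by
  obtain ⟨_, hA, _, hB, rfl⟩ := Submodule.mem_sup.1 hl
  obtain ⟨A, rfl⟩ := (Submodule.mem_span_range_iff_exists_fun ℝ).1 hA
  obtain ⟨B, rfl⟩ := (Submodule.mem_span_range_iff_exists_fun ℝ).1 hB
  exact ⟨A, B, fun F => by simp [LinearMap.sum_apply, Finset.sum_add_distrib]⟩

lemma apply_congr (hl : l ∈ TwoPoint T m) {F G : Jet}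
    (h : ∀ k < m, F k (-T) = G k (-T)) (h' : ∀ k < m, F k T = G k T) : l F = l G := by
  obtain ⟨A, B, hAB⟩ := exists_coeff hl
  simp only [hAB, h _ (Fin.is_lt _), h' _ (Fin.is_lt _)]

lemma continuous_apply {X : Type*} [TopologicalSpace X] (hl : l ∈ TwoPoint T m) {F : X → Jet}
    (h : ∀ k, Continuous fun s => F s k (-T)) (h' : ∀ k, Continuous fun s => F s k T) :
    Continuous fun s => l (F s) := by
  obtain ⟨A, B, hAB⟩ := exists_coeff hl
  simp only [hAB]
  exact continuous_finsetSum _ fun k _ => ((h k).const_mul (A k)).add ((h' k).const_mul (B k))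

lemma evalAt_comp_toEnd_mem {R : ReflOp} (hR : R.order ≤ n) {k : ℕ} (hk : k + n < m) {t : ℝ}
    (ht : t = -T ∨ t = T) : evalAt k t ∘ₗ R.toEnd ∈ TwoPoint T m := by
  obtain ⟨hrefl, hplain⟩ := ReflOp.order_le_iff.1 hR
  have expansion : evalAt k t ∘ₗ R.toEnd = ∑ i ∈ Finset.range (n + 1),
      (((-1) ^ k * R.refl.coeff i) • evalAt (k + i) (-t) + R.plain.coeff i • evalAt (k + i) t) := by
    ext F
    simp only [LinearMap.comp_apply, evalAt_apply, ReflOp.toEnd_apply, LinearMap.sum_apply,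
      LinearMap.add_apply, LinearMap.smul_apply, smul_eq_mul, Finset.sum_add_distrib,
      aeval_shift_apply_of_le hrefl, aeval_shift_apply_of_le hplain, Finset.mul_sum, mul_assoc]
  have ht' : -t = -T ∨ -t = T := by rcases ht with rfl | rfl <;> simp
  rw [expansion]
  refine Submodule.sum_mem _ fun i hi => ?_
  have hi : k + i < m := by have := Finset.mem_range.1 hi; omega
  exact Submodule.add_mem _ (Submodule.smul_mem _ _ (evalAt_mem hi ht'))
    (Submodule.smul_mem _ _ (evalAt_mem hi ht))

end TwoPoint

end Jet

/-- On functions that have near the endpoints of `[-T, T]` a jet up to the order `m - 1`, the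
functionals `C` are given by the functionals `Λ` of that jet. -/
def Represents {ι : Type} (T : ℝ) (m : ℕ) (C : ι → (ℝ → ℝ) → ℝ) (Λ : ι → Jet →ₗ[ℝ] ℝ) : Prop :=
  ∀ U : Set ℝ, IsOpen U → (∀ t ∈ U, -t ∈ U) → T ∈ U → ∀ (u : ℝ → ℝ) (F : Jet),
    IsJet (m - 1) (Icc (-T) T) U u F → ∀ i, C i u = Λ i F

lemma Represents.apply_eq_of_isJet_compl {ι : Type} {T s : ℝ} {m : ℕ} {C : ι → (ℝ → ℝ) → ℝ}
    {Λ : ι → Jet →ₗ[ℝ] ℝ} (hC : Represents T m C Λ) (hs : s ∈ Ioo (-T) T) {u : ℝ → ℝ} {F : Jet}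
    (h : IsJet (m - 1) (Icc (-T) T) {s}ᶜ u F) (i : ι) : C i u = Λ i F := by
  refine hC ({s, -s}ᶜ : Set ℝ) (Set.toFinite _).isClosed.isOpen_compl (fun t ht => ?_) ?_ u F
    (h.mono le_rfl (compl_subset_compl.2 (by simp))) i
  · simp only [mem_compl_iff, mem_insert_iff, mem_singleton_iff, not_or, neg_inj] at ht ⊢
    exact ⟨fun h => ht.2 (neg_eq_iff_eq_neg.1 h), ht.1⟩
  · simp only [mem_compl_iff, mem_insert_iff, mem_singleton_iff, not_or]
    exact ⟨hs.2.ne', fun h => hs.1.ne (neg_eq_iff_eq_neg.2 h)⟩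

section Boundary

variable {T : ℝ} {n : ℕ} (α β : Fin n → Fin n → ℝ)

variable (T) in
/-- The functional `B_i` on jets. -/
def bdryJet (i : Fin n) : Jet →ₗ[ℝ] ℝ :=
  ∑ j : Fin n, (α i j • evalAt j (-T) + β i j • evalAt j T)

variable (T) in
/-- The functionals `B_i R` and `B_i` on jets. -/
def reducedJet (R : ReflOp) : Fin n ⊕ Fin n → (Jet →ₗ[ℝ] ℝ)
  | Sum.inl i => bdryJet T α β i ∘ₗ R.toEnd
  | Sum.inr i => bdryJet T α β i

lemma represents_bdry (hT : 0 < T) : Represents T n (bdry T α β) (bdryJet T α β) := by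
  intro U hU hU' hTU u F hF i
  have deriv_eq (j : Fin n) {t : ℝ} (ht : t ∈ Icc (-T) T ∩ U) :
      iteratedDerivWithin j u (Icc (-T) T) t = F j t :=
    hF.iteratedDerivWithin_eq (uniqueDiffOn_Icc (by linarith)) hU (by omega) ht
  simp only [bdry, bdryJet, LinearMap.sum_apply, LinearMap.add_apply, LinearMap.smul_apply,
    evalAt_apply, smul_eq_mul, deriv_eq _ ⟨left_mem_Icc.2 (by linarith), hU' T hTU⟩,
    deriv_eq _ ⟨right_mem_Icc.2 (by linarith), hTU⟩]

lemma bdryJet_mem_twoPoint {m : ℕ} (hm : n ≤ m) (i : Fin n) : bdryJet T α β i ∈ TwoPoint T m :=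
  Submodule.sum_mem _ fun j _ => Submodule.add_mem _
    (Submodule.smul_mem _ _ (TwoPoint.evalAt_mem (j.2.trans_le hm) (.inl rfl)))
    (Submodule.smul_mem _ _ (TwoPoint.evalAt_mem (j.2.trans_le hm) (.inr rfl)))

variable {R : ReflOp} (hR : R.order ≤ n)
include hR

lemma represents_reducedBdry (hT : 0 < T) :
    Represents T (2 * n) (reducedBdry T α β R) (reducedJet T α β R) := by
  rintro U hU hU' hTU u F hF (i | i)
  · have := i.pos
    exact represents_bdry α β hT U hU hU' hTU _ _ ((hF.mono (by omega) subset_rfl).act hR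
      (uniqueDiffOn_Icc (by linarith)) hU (fun _ => neg_mem_Icc_neg) hU') i
  · exact represents_bdry α β hT U hU hU' hTU u F (hF.mono (by omega) subset_rfl) i

lemma reducedJet_mem_twoPoint (i : Fin n ⊕ Fin n) :
    reducedJet T α β R i ∈ TwoPoint T (2 * n) := by
  rcases i with i | i
  · have expansion : reducedJet T α β R (Sum.inl i) = ∑ j : Fin n,
        (α i j • (evalAt j (-T) ∘ₗ R.toEnd) + β i j • (evalAt j T ∘ₗ R.toEnd)) := by
      ext F
      simp [reducedJet, bdryJet]
    rw [expansion]
    exact Submodule.sum_mem _ fun j _ => Submodule.add_mem _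
      (Submodule.smul_mem _ _ (TwoPoint.evalAt_comp_toEnd_mem hR (by omega) (.inl rfl)))
      (Submodule.smul_mem _ _ (TwoPoint.evalAt_comp_toEnd_mem hR (by omega) (.inr rfl)))
  · exact bdryJet_mem_twoPoint α β (by omega) i

end Boundary

/-! ### Existence of the Green's function -/

namespace Jet

/-- The jet of `t ↦ g (t - s)` to the right of `s`, and zero to the left. -/
def stepJet (g : Jet) (s : ℝ) : Jet := fun k t => if s < t then g k (t - s) else 0

/-- The jet of `t ↦ g (t - s)` on the positive half-line, and zero on the negative one. At `±T` it
agrees with `stepJet g s` for `s` in `(-T, T)`, but it is continuous in all `s`, up to the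
endpoints. -/
def halfJet (g : Jet) (s : ℝ) : Jet := fun k t => if 0 < t then g k (t - s) else 0

/-- The jet, in the first variable, of the Green's function built on the fundamental solution `g`
and the basis `v` dual to the functionals `Λ`. -/
def greenJet {ι : Type*} [Fintype ι] (g : Jet) (Λ : ι → Jet →ₗ[ℝ] ℝ) (v : ι → Jet) (s : ℝ) : Jet :=
  stepJet g s - ∑ i, Λ i (halfJet g s) • v i

variable {S : ℝ[X]} {g : Jet} {s t T : ℝ} {k m : ℕ}

lemma stepJet_of_lt (h : s < t) : stepJet g s k t = g k (t - s) := if_pos h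

lemma stepJet_of_le (h : t ≤ s) : stepJet g s k t = 0 := if_neg h.not_gt

lemma stepJet_eq_max (h : g k 0 = 0) : stepJet g s k t = g k (max (t - s) 0) := by
  rcases lt_or_ge s t with hst | hst
  · rw [stepJet_of_lt hst, max_eq_left (sub_nonneg.2 hst.le)]
  · rw [stepJet_of_le hst, max_eq_right (sub_nonpos.2 hst), h]

lemma hasDerivAt_stepJet_of_ne (hg : g ∈ Sol S) (h : t ≠ s) (k : ℕ) :
    HasDerivAt (stepJet g s k) (stepJet g s (k + 1) t) t := by
  rcases lt_or_gt_of_ne h with h | h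
  · rw [stepJet_of_le h.le]
    refine (hasDerivAt_const t (0 : ℝ)).congr_of_eventuallyEq ?_
    filter_upwards [Iio_mem_nhds h] with x hx using stepJet_of_le (le_of_lt hx)
  · rw [stepJet_of_lt h]
    refine ((hg.1 k (t - s)).comp_sub_const t s).congr_of_eventuallyEq ?_
    filter_upwards [Ioi_mem_nhds h] with x hx using stepJet_of_lt hx

lemma hasDerivAt_stepJet_of_eq_zero (hg : g ∈ Sol S) (h : g k 0 = 0) (h' : g (k + 1) 0 = 0)
    (t : ℝ) : HasDerivAt (stepJet g s k) (stepJet g s (k + 1) t) t := by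
  rcases eq_or_ne t s with rfl | hts
  · rw [stepJet_of_le le_rfl, ← hasDerivWithinAt_univ, ← Iic_union_Ici (a := t)]
    refine .union ?_ ?_
    · exact (hasDerivWithinAt_const t (Iic t) (0 : ℝ)).congr (fun x hx => stepJet_of_le hx)
        (stepJet_of_le le_rfl)
    · have right := ((hg.1 k (t - t)).comp_sub_const t t).hasDerivWithinAt (s := Ici t)
      rw [sub_self, h'] at right
      exact right.congr (fun x hx => by rw [stepJet_eq_max h, max_eq_left (sub_nonneg.2 hx)])
        (by rw [stepJet_eq_max h, max_eq_left (sub_self t).ge])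
  · exact hasDerivAt_stepJet_of_ne hg hts k

lemma aeval_shift_stepJet (hg : g ∈ Sol S) : aeval shift S (stepJet g s) = 0 := by
  ext k t
  rcases lt_or_ge s t with h | h
  · rw [Pi.zero_apply, Pi.zero_apply, ← Sol.aeval_eq_zero hg k (t - s)]
    simp only [aeval_shift_apply, stepJet_of_lt h]
  · simp [aeval_shift_apply, stepJet_of_le h, Polynomial.sum]

lemma continuous_apply_halfJet (hT : 0 < T) (hg : g ∈ Sol S) {l : Jet →ₗ[ℝ] ℝ}
    (hl : l ∈ TwoPoint T m) : Continuous fun s => l (halfJet g s) := by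
  refine TwoPoint.continuous_apply hl (fun k => ?_) fun k => ?_
  · simp only [halfJet, if_neg (show ¬0 < -T by linarith)]
    exact continuous_const
  · simp only [halfJet, if_pos hT]
    exact (Sol.continuous hg k).comp (by fun_prop)

lemma TwoPoint.apply_stepJet (hs : s ∈ Ioo (-T) T) {l : Jet →ₗ[ℝ] ℝ} (hl : l ∈ TwoPoint T m) :
    l (stepJet g s) = l (halfJet g s) := by
  have hT : 0 < T := by linarith [hs.1, hs.2]
  refine apply_congr hl (fun k _ => ?_) fun k _ => ?_
  · rw [stepJet_of_le hs.1.le, halfJet, if_neg (by linarith)]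
  · rw [stepJet_of_lt hs.2, halfJet, if_pos hT]

section Green

variable {ι : Type} [Fintype ι] {Λ : ι → Jet →ₗ[ℝ] ℝ} {v : ι → Jet}

lemma greenJet_apply :
    greenJet g Λ v s k t = stepJet g s k t - ∑ i, Λ i (halfJet g s) * v i k t := by
  simp [greenJet, Finset.sum_apply]

variable [DecidableEq ι]

lemma hasDerivAt_greenJet_of_ne (hg : g ∈ Sol S) (hv : IsDualBasis S Λ v) (h : t ≠ s) (k : ℕ) :
    HasDerivAt (greenJet g Λ v s k) (greenJet g Λ v s (k + 1) t) t :=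
  (hasDerivAt_stepJet_of_ne hg h k).sub ((hv.sum_smul_mem _).1 k t)

lemma isJet_greenJet (hg : g ∈ Sol S) (hv : IsDualBasis S Λ v) {N : ℕ} {I U : Set ℝ}
    (h : I ∩ U ⊆ {s}ᶜ) : IsJet N I U (greenJet g Λ v s 0) (greenJet g Λ v s) where
  eqOn _ _ := rfl
  hasDeriv k _ _ ht := (hasDerivAt_greenJet_of_ne hg hv (h ht) k).hasDerivWithinAt

lemma isJet_greenJet_of_low (hg : IsFundamental S g) (hv : IsDualBasis S Λ v)
    (hk : k + 2 ≤ S.natDegree) {I U : Set ℝ} :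
    IsJet k I U (greenJet g Λ v s 0) (greenJet g Λ v s) where
  eqOn _ _ := rfl
  hasDeriv j hj t _ := ((hasDerivAt_stepJet_of_eq_zero hg.mem (hg.low j (by omega))
    (hg.low (j + 1) (by omega)) t).sub ((hv.sum_smul_mem _).1 j t)).hasDerivWithinAt

lemma aeval_shift_greenJet (hg : g ∈ Sol S) (hv : IsDualBasis S Λ v) :
    aeval shift S (greenJet g Λ v s) = 0 := by
  rw [greenJet, map_sub, aeval_shift_stepJet hg, (hv.sum_smul_mem _).2, sub_zero]

lemma uniqueDiffOn_Icc_diff {a b : ℝ} (hab : a < b) (s : ℝ) : UniqueDiffOn ℝ (Icc a b \ {s}) := by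
  rw [sdiff_eq]
  exact (uniqueDiffOn_Icc hab).inter isOpen_compl_singleton

lemma iteratedDerivWithin_greenJet (hT : 0 < T) (hg : g ∈ Sol S) (hv : IsDualBasis S Λ v)
    (ht : t ∈ Icc (-T) T \ {s}) :
    iteratedDerivWithin k (greenJet g Λ v s 0) (Icc (-T) T \ {s}) t = greenJet g Λ v s k t :=
  (isJet_greenJet hg hv fun _ hx => hx.1.2).iteratedDerivWithin_eq
    (uniqueDiffOn_Icc_diff (by linarith) s) isOpen_univ le_rfl ⟨ht, mem_univ t⟩

lemma apply_greenJet (hv : IsDualBasis S Λ v) {i : ι} (hΛ : Λ i ∈ TwoPoint T m)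
    (hs : s ∈ Ioo (-T) T) : Λ i (greenJet g Λ v s) = 0 := by
  rw [greenJet, map_sub, TwoPoint.apply_stepJet hs hΛ, hv.apply_sum_smul, sub_self]

section Continuity

variable (hT : 0 < T) (hg : g ∈ Sol S) (hΛ : ∀ i, Λ i ∈ TwoPoint T m) (hv : IsDualBasis S Λ v)
include hT hg hΛ hv

lemma continuous_sum_halfJet (k : ℕ) :
    Continuous fun p : ℝ × ℝ => ∑ i, Λ i (halfJet g p.2) * v i k p.1 :=
  continuous_finsetSum _ fun i _ =>
    ((continuous_apply_halfJet hT hg (hΛ i)).comp continuous_snd).mul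
      ((Sol.continuous (hv.mem i) k).comp continuous_fst)

lemma continuous_greenJet (h : g k 0 = 0) :
    Continuous fun p : ℝ × ℝ => greenJet g Λ v p.2 k p.1 := by
  simp only [greenJet_apply, stepJet_eq_max h]
  exact ((Sol.continuous hg k).comp (by fun_prop)).sub (continuous_sum_halfJet hT hg hΛ hv k)

lemma continuousAt_greenJet {p : ℝ × ℝ} (hp : p.1 ≠ p.2) :
    ContinuousAt (fun p : ℝ × ℝ => greenJet g Λ v p.2 k p.1) p := by
  simp only [greenJet_apply]
  refine .sub ?_ (continuous_sum_halfJet hT hg hΛ hv k).continuousAt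
  rcases lt_or_gt_of_ne hp with h | h
  · refine (continuousAt_const (y := (0 : ℝ))).congr ?_
    filter_upwards [(isOpen_lt continuous_fst continuous_snd).mem_nhds h] with p hp
    exact (stepJet_of_le (le_of_lt hp)).symm
  · have : Continuous fun p : ℝ × ℝ => g k (p.1 - p.2) :=
      (Sol.continuous hg k).comp (by fun_prop)
    refine this.continuousAt.congr ?_
    filter_upwards [(isOpen_lt continuous_snd continuous_fst).mem_nhds h] with p hp
    exact (stepJet_of_lt hp).symm

lemma tendsto_greenJet_left (t : ℝ) : Tendsto (fun s => greenJet g Λ v s k t) (𝓝[<] t)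
    (𝓝 (g k 0 - ∑ i, Λ i (halfJet g t) * v i k t)) := by
  have sum_continuous : Continuous fun s => ∑ i, Λ i (halfJet g s) * v i k t :=
    (continuous_sum_halfJet hT hg hΛ hv k).comp (.prodMk_right t)
  have g_continuous : Continuous fun s => g k (t - s) := (Sol.continuous hg k).comp (by fun_prop)
  have limit := ((g_continuous.fun_sub sum_continuous).tendsto t).mono_left
    (nhdsWithin_le_nhds (s := Iio t))
  rw [sub_self] at limit
  refine limit.congr' ?_
  filter_upwards [self_mem_nhdsWithin] with s hs
  rw [greenJet_apply, stepJet_of_lt hs]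

lemma tendsto_greenJet_right (t : ℝ) : Tendsto (fun s => greenJet g Λ v s k t) (𝓝[>] t)
    (𝓝 (-∑ i, Λ i (halfJet g t) * v i k t)) := by
  have sum_continuous : Continuous fun s => ∑ i, Λ i (halfJet g s) * v i k t :=
    (continuous_sum_halfJet hT hg hΛ hv k).comp (.prodMk_right t)
  refine ((sum_continuous.fun_neg.tendsto t).mono_left (nhdsWithin_le_nhds (s := Ioi t))).congr' ?_
  filter_upwards [self_mem_nhdsWithin] with s hs
  rw [greenJet_apply, stepJet_of_le (le_of_lt hs), zero_sub]

end Continuity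

theorem isGreen_greenJet (hT : 0 < T) (hg : IsFundamental S g)
    (hΛ : ∀ i, Λ i ∈ TwoPoint T S.natDegree) (hv : IsDualBasis S Λ v)
    {C : ι → (ℝ → ℝ) → ℝ} (hC : Represents T S.natDegree C Λ) :
    IsGreen T S C fun t s => greenJet g Λ v s 0 t where
  exists_low k hk s _ := (isJet_greenJet_of_low hg hv hk).contDiffOn
    (uniqueDiffOn_Icc (by linarith)) <|
      ((continuous_greenJet hT hg.mem hΛ hv (hg.low k hk)).comp (.prodMk_left s)).continuousOn
  continuous_low k hk := by
    refine (continuous_greenJet hT hg.mem hΛ hv (hg.low k hk)).continuousOn.congr fun p hp => ?_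
    exact (isJet_greenJet_of_low hg hv hk).iteratedDerivWithin_eq (uniqueDiffOn_Icc (by linarith))
      isOpen_univ le_rfl ⟨hp.1, mem_univ p.1⟩
  exists_high s _ := (isJet_greenJet hg.mem hv fun _ hx => hx.1.2).contDiffOn
    (uniqueDiffOn_Icc_diff (by linarith) s) fun t ht =>
      (hasDerivAt_greenJet_of_ne hg.mem hv ht.2 _).continuousAt.continuousWithinAt
  continuous_high k _ _ := by
    refine ContinuousOn.congr (f := fun p : ℝ × ℝ => greenJet g Λ v p.2 k p.1)
      (fun p hp => (continuousAt_greenJet hT hg.mem hΛ hv hp.2).continuousWithinAt) fun p hp => ?_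
    exact iteratedDerivWithin_greenJet hT hg.mem hv ⟨hp.1.1, hp.2⟩
  jump k hk t ht := by
    have deriv_eq (s : ℝ) (hs : t ≠ s) :=
      iteratedDerivWithin_greenJet (k := k) (t := t) hT hg.mem hv ⟨Ioo_subset_Icc_self ht, hs⟩
    refine ⟨_, _, (tendsto_greenJet_left hT hg.mem hΛ hv t).congr' ?_,
      (tendsto_greenJet_right hT hg.mem hΛ hv t).congr' ?_, by rw [hg.top k hk]; ring⟩
    all_goals filter_upwards [self_mem_nhdsWithin] with s hs
    · exact (deriv_eq s (ne_of_gt hs)).symm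
    · exact (deriv_eq s (ne_of_lt hs)).symm
  equation s _ t ht := by
    rw [diffOp_eq_aeval_shift le_rfl fun k _ => iteratedDerivWithin_greenJet hT hg.mem hv ht,
      aeval_shift_greenJet hg.mem hv]
    rfl
  conditions s hs i := by
    rw [hC.apply_eq_of_isJet_compl hs (isJet_greenJet hg.mem hv inter_subset_right),
      apply_greenJet hv (hΛ i) hs]

end Green

end Jet

/-! ### Uniqueness of the Green's function -/

namespace Jet

/-- The jet of the solution of `S u = 0` on the line which has the same data at `e` as
`G (·, s)`. -/
def branchJet {S : ℝ[X]} (hS : S ≠ 0) (T : ℝ) (G : ℝ → ℝ → ℝ) (e s : ℝ) : Jet :=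
  Sol.ofData hS e fun k => iteratedDerivWithin k (fun t => G t s) (Icc (-T) T \ {s}) e

section Branches

variable {S : ℝ[X]} {s t e T : ℝ} {k : ℕ} {G : ℝ → ℝ → ℝ} {ι : Type} {C : ι → (ℝ → ℝ) → ℝ}

lemma iteratedDerivWithin_diff_singleton {u : ℝ → ℝ} {I : Set ℝ} (h : t ≠ s) :
    iteratedDerivWithin k u (I \ {s}) t = iteratedDerivWithin k u I t := by
  rw [iteratedDerivWithin, iteratedDerivWithin, sdiff_eq,
    iteratedFDerivWithin_inter (isOpen_compl_singleton.mem_nhds h)]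

lemma continuousOn_iteratedDerivWithin_green (hG : IsGreen T S C G) (ht : t ∈ Icc (-T) T)
    (hk : k ≤ S.natDegree) :
    ContinuousOn (fun s => iteratedDerivWithin k (fun t => G t s) (Icc (-T) T \ {s}) t)
      (Icc (-T) T \ {t}) := by
  have pair_continuous : ContinuousOn (fun s : ℝ => (t, s)) (Icc (-T) T \ {t}) := by fun_prop
  by_cases h : k + 2 ≤ S.natDegree
  · exact ((hG.continuous_low k h).comp pair_continuous fun s hs => ⟨ht, hs.1⟩).congr
      fun s hs => iteratedDerivWithin_diff_singleton (Ne.symm hs.2)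
  · exact (hG.continuous_high k hk (by omega)).comp pair_continuous
      fun s hs => ⟨⟨ht, hs.1⟩, fun h : t = s => hs.2 h.symm⟩

lemma branchJet_mem (hS : S ≠ 0) : branchJet hS T G e s ∈ Sol S := Sol.ofData_mem hS e _

lemma iteratedDerivWithin_eq_branchJet (hS : S ≠ 0) (hT : 0 < T) (hG : IsGreen T S C G)
    (hs : s ∈ Ioo (-T) T) (he : e ∈ Icc (-T) T) (ht : t ∈ Icc (-T) T) (hst : s ∉ uIcc e t)
    (hk : k ≤ S.natDegree) :
    iteratedDerivWithin k (fun t => G t s) (Icc (-T) T \ {s}) t = branchJet hS T G e s k t := by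
  have hsub : uIcc e t ⊆ Icc (-T) T \ {s} :=
    fun x hx => ⟨ordConnected_Icc.uIcc_subset he ht hx, fun h => hst (h ▸ hx)⟩
  have hN : branchJet hS T G e s ∈ Sol S := branchJet_mem hS
  let D : Jet := fun k => iteratedDerivWithin k (fun t => G t s) (Icc (-T) T \ {s})
  have D_hasDeriv : ∀ k < S.natDegree, ∀ x ∈ uIcc e t,
      HasDerivWithinAt (D k) (D (k + 1) x) (uIcc e t) x := fun k hk x hx => by
    have := (hG.exists_high s (Ioo_subset_Icc_self hs)).differentiableOn_iteratedDerivWithin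
      (m := k) (by exact_mod_cast hk) (uniqueDiffOn_Icc_diff (by linarith) s) x (hsub hx)
    simpa only [D, iteratedDerivWithin_succ] using this.hasDerivWithinAt.mono hsub
  have D_equation : ∀ x ∈ uIcc e t, aeval shift S D 0 x = 0 := fun x hx => by
    rw [← diffOp_eq_aeval_shift le_rfl fun k _ => rfl]
    exact hG.equation s hs x (hsub hx)
  refine sub_eq_zero.1 (eq_zero_of_aeval_shift_eq_zero (F := D - branchJet hS T G e s)
    (t₀ := e) hS ordConnected_uIcc (fun k hk x hx => ?_) (fun x hx => ?_) left_mem_uIcc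
    (fun k hk => ?_) right_mem_uIcc hk)
  · exact (D_hasDeriv k hk x hx).sub (hN.1 k x).hasDerivWithinAt
  · rw [map_sub, hN.2, sub_zero, D_equation x hx]
  · exact sub_eq_zero.2 (Sol.ofData_apply_self hS e (fun j => D j e) ⟨k, hk⟩).symm

lemma continuousOn_branchJet (hS : S ≠ 0) (hG : IsGreen T S C G) (he : e ∈ Icc (-T) T) (k : ℕ)
    (t : ℝ) : ContinuousOn (fun s => branchJet hS T G e s k t) (Icc (-T) T \ {e}) :=
  (evalAt k t ∘ₗ Sol.ofData hS e).continuous_of_finiteDimensional.comp_continuousOn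
    (continuousOn_pi.2 fun j => continuousOn_iteratedDerivWithin_green hG he j.2.le)

lemma branchJet_eq_of_tendsto (hS : S ≠ 0) (hT : 0 < T) (hG : IsGreen T S C G)
    (hs : s ∈ Ioo (-T) T) (he : e ∈ Icc (-T) T) (hse : s ≠ e) {l : Filter ℝ} [l.NeBot]
    (hl : l ≤ 𝓝 s) (hmem : ∀ᶠ σ in l, σ ∉ uIcc e s) (hk : k ≤ S.natDegree) {y : ℝ}
    (hy : Tendsto (fun σ => iteratedDerivWithin k (fun t => G t σ) (Icc (-T) T \ {σ}) s) l (𝓝 y)) :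
    branchJet hS T G e s k s = y := by
  have continuousAt : ContinuousAt (fun σ => branchJet hS T G e σ k s) s :=
    (continuousOn_branchJet hS hG he k s).continuousAt
      (inter_mem (Icc_mem_nhds hs.1 hs.2) (isOpen_ne.mem_nhds hse))
  refine tendsto_nhds_unique ((continuousAt.tendsto.mono_left hl).congr' ?_) hy
  filter_upwards [hmem, hl (Ioo_mem_nhds hs.1 hs.2)] with σ hσ hσ'
  exact (iteratedDerivWithin_eq_branchJet hS hT hG hσ' he (Ioo_subset_Icc_self hs) hσ hk).symm

variable {g : Jet}

lemma exists_tendsto_sub_eq (hg : IsFundamental S g) (hG : IsGreen T S C G)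
    (hs : s ∈ Ioo (-T) T) (hk : k < S.natDegree) : ∃ below above : ℝ,
    Tendsto (fun σ => iteratedDerivWithin k (fun t => G t σ) (Icc (-T) T \ {σ}) s)
      (𝓝[<] s) (𝓝 below) ∧
    Tendsto (fun σ => iteratedDerivWithin k (fun t => G t σ) (Icc (-T) T \ {σ}) s)
      (𝓝[>] s) (𝓝 above) ∧
    below - above = g k 0 := by
  rcases (Nat.succ_le_of_lt hk).lt_or_eq with hk | hk
  · have continuousAt : ContinuousAt
        (fun σ => iteratedDerivWithin k (fun t => G t σ) (Icc (-T) T) s) s :=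
      ((hG.continuous_low k hk).comp (f := fun σ => (s, σ)) (by fun_prop)
        fun σ hσ => ⟨Ioo_subset_Icc_self hs, hσ⟩).continuousAt (Icc_mem_nhds hs.1 hs.2)
    refine ⟨_, _, (continuousAt.mono_left nhdsWithin_le_nhds).congr' ?_,
      (continuousAt.mono_left nhdsWithin_le_nhds).congr' ?_, by rw [hg.low k hk, sub_self]⟩
    all_goals filter_upwards [self_mem_nhdsWithin] with σ hσ
    · exact (iteratedDerivWithin_diff_singleton (ne_of_gt hσ)).symm
    · exact (iteratedDerivWithin_diff_singleton (ne_of_lt hσ)).symm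
  · rw [hg.top k hk]
    exact hG.jump k hk s hs

lemma branchJet_right_eq (hS : S ≠ 0) (hT : 0 < T) (hg : IsFundamental S g)
    (hG : IsGreen T S C G) (hs : s ∈ Ioo (-T) T) :
    branchJet hS T G T s = branchJet hS T G (-T) s + translate s g := by
  refine sub_eq_zero.1 (Sol.eq_zero_of_data_eq_zero hS (Submodule.sub_mem _ (branchJet_mem hS)
    (Submodule.add_mem _ (branchJet_mem hS) (Sol.translate_mem hg.mem s))) s fun k hk => ?_)
  obtain ⟨below, above, hbelow, habove, jump⟩ := exists_tendsto_sub_eq hg hG hs hk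
  have right : branchJet hS T G T s k s = below := by
    refine branchJet_eq_of_tendsto hS hT hG hs (right_mem_Icc.2 (by linarith)) hs.2.ne
      nhdsWithin_le_nhds ?_ hk.le hbelow
    filter_upwards [self_mem_nhdsWithin] with σ hσ
    rw [uIcc_of_ge hs.2.le]
    exact fun h => h.1.not_gt hσ
  have left : branchJet hS T G (-T) s k s = above := by
    refine branchJet_eq_of_tendsto hS hT hG hs (left_mem_Icc.2 (by linarith)) hs.1.ne'
      nhdsWithin_le_nhds ?_ hk.le habove
    filter_upwards [self_mem_nhdsWithin] with σ hσ
    rw [uIcc_of_le hs.1.le]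
    exact fun h => h.2.not_gt hσ
  change _ - (_ + g k (s - s)) = (0 : ℝ)
  rw [right, left, sub_self, ← jump]
  ring

lemma eq_stepJet_add_branchJet (hS : S ≠ 0) (hT : 0 < T) (hg : IsFundamental S g)
    (hG : IsGreen T S C G) (hs : s ∈ Ioo (-T) T) (ht : t ∈ Icc (-T) T) (hts : t ≠ s) :
    G t s = (stepJet g s + branchJet hS T G (-T) s) 0 t := by
  have branch {e : ℝ} (he : e ∈ Icc (-T) T) (hst : s ∉ uIcc e t) :
      G t s = branchJet hS T G e s 0 t := by
    simpa only [iteratedDerivWithin_zero]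
      using iteratedDerivWithin_eq_branchJet hS hT hG hs he ht hst (Nat.zero_le _)
  change _ = stepJet g s 0 t + branchJet hS T G (-T) s 0 t
  rcases lt_or_gt_of_ne hts with h | h
  · rw [stepJet_of_le h.le, zero_add]
    refine branch (left_mem_Icc.2 (by linarith)) ?_
    rw [uIcc_of_le ht.1]
    exact fun hs => hs.2.not_gt h
  · rw [branch (right_mem_Icc.2 (by linarith)) ?_, branchJet_right_eq hS hT hg hG hs,
      stepJet_of_lt h, add_comm]
    · rfl
    · rw [uIcc_of_ge ht.2]
      exact fun hs => hs.1.not_gt h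

end Branches

variable {S : ℝ[X]} {g : Jet} {s t T : ℝ} {G : ℝ → ℝ → ℝ} {ι : Type} [Fintype ι] [DecidableEq ι]
  {C : ι → (ℝ → ℝ) → ℝ} {Λ : ι → Jet →ₗ[ℝ] ℝ} {v : ι → Jet} (hS : 2 ≤ S.natDegree) (hT : 0 < T)
  (hg : IsFundamental S g) (hΛ : ∀ i, Λ i ∈ TwoPoint T S.natDegree) (hv : IsDualBasis S Λ v)
  (hC : Represents T S.natDegree C Λ) (hG : IsGreen T S C G)
include hS hT hg hΛ hv hC hG

lemma eq_greenJet_of_ne (hs : s ∈ Ioo (-T) T) (ht : t ∈ Icc (-T) T) (hts : t ≠ s) :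
    G t s = greenJet g Λ v s 0 t := by
  have hS : S ≠ 0 := Polynomial.ne_zero_of_natDegree_gt hS
  set N := branchJet hS T G (-T) s with hN
  have N_mem : N ∈ Sol S := branchJet_mem hS
  have isJet : IsJet (S.natDegree - 1) (Icc (-T) T) {s}ᶜ (fun t => G t s) (stepJet g s + N) :=
    { eqOn := fun t ht => eq_stepJet_add_branchJet hS hT hg hG hs ht.1 ht.2
      hasDeriv := fun k _ t ht =>
        ((hasDerivAt_stepJet_of_ne hg.mem ht.2 k).add (N_mem.1 k t)).hasDerivWithinAt }
  have conditions (i : ι) : Λ i N = -Λ i (halfJet g s) := by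
    have := hG.conditions s hs i
    rw [hC.apply_eq_of_isJet_compl hs isJet, map_add, TwoPoint.apply_stepJet hs (hΛ i)] at this
    linarith
  have N_eq : N = -∑ i, Λ i (halfJet g s) • v i := by
    rw [← Finset.sum_neg_distrib, ← hv.sum_smul_eq N N_mem]
    exact Finset.sum_congr rfl fun i _ => by rw [conditions, neg_smul]
  rw [eq_stepJet_add_branchJet hS hT hg hG hs ht hts, ← hN, N_eq, ← sub_eq_add_neg, greenJet]

theorem eq_greenJet (ht : t ∈ Icc (-T) T) (hs : s ∈ Icc (-T) T) :
    G t s = greenJet g Λ v s 0 t := by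
  have hT' : -T < T := by linarith
  have G_continuous : ContinuousOn (fun p : ℝ × ℝ => G p.1 p.2) (Icc (-T) T ×ˢ Icc (-T) T) := by
    simpa only [iteratedDerivWithin_zero] using hG.continuous_low 0 hS
  have greenJet_continuous : Continuous fun p : ℝ × ℝ => greenJet g Λ v p.2 0 p.1 :=
    continuous_greenJet hT hg.mem hΛ hv (hg.low 0 hS)
  have interior {σ : ℝ} (hσ : σ ∈ Ioo (-T) T) : G t σ = greenJet g Λ v σ 0 t := by
    have off_diagonal : EqOn (fun t => G t σ) (fun t => greenJet g Λ v σ 0 t)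
        (Ioo (-T) T ∩ {σ}ᶜ) := fun x hx =>
      eq_greenJet_of_ne hS hT hg hΛ hv hC hG hσ (Ioo_subset_Icc_self hx.1) hx.2
    refine off_diagonal.of_subset_closure (t := Icc (-T) T)
      (G_continuous.comp (f := fun t : ℝ => (t, σ)) (by fun_prop)
        fun x hx => ⟨hx, Ioo_subset_Icc_self hσ⟩)
      (greenJet_continuous.comp (.prodMk_left σ)).continuousOn
      (inter_subset_left.trans Ioo_subset_Icc_self) ?_ ht
    rw [← closure_Ioo hT'.ne]
    exact closure_minimal ((dense_compl_singleton σ).open_subset_closure_inter isOpen_Ioo)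
      isClosed_closure
  have agree : EqOn (fun σ => G t σ) (fun σ => greenJet g Λ v σ 0 t) (Ioo (-T) T) :=
    fun σ hσ => interior hσ
  exact agree.of_subset_closure (t := Icc (-T) T)
    (G_continuous.comp (f := fun σ : ℝ => (t, σ)) (by fun_prop) fun x hx => ⟨ht, hx⟩)
    (greenJet_continuous.comp (.prodMk_right t)).continuousOn
    Ioo_subset_Icc_self (closure_Ioo hT'.ne).ge hs

end Jet

/-! ### Integration against the Green's function -/

section ToEnd

variable (R : ReflOp) {K : ℝ → Jet} {h : ℝ → ℝ} {a b : ℝ}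
  (hK : ∀ k t, IntervalIntegrable (fun s => K s k t * h s) volume a b)
include hK

lemma ReflOp.intervalIntegrable_toEnd_mul (t : ℝ) :
    IntervalIntegrable (fun s => R.toEnd (K s) 0 t * h s) volume a b := by
  simp only [toEnd_apply_of_order_le le_rfl, Finset.sum_mul, add_mul, mul_assoc]
  simpa only [Finset.sum_fn] using IntervalIntegrable.sum (Finset.range (R.order + 1)) fun i _ =>
    ((hK i (-t)).const_mul (R.refl.coeff i)).add ((hK i t).const_mul (R.plain.coeff i))

lemma ReflOp.integral_toEnd_mul (t : ℝ) :
    ∫ s in a..b, R.toEnd (K s) 0 t * h s = R.toEnd (fun k t => ∫ s in a..b, K s k t * h s) 0 t := by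
  simp only [toEnd_apply_of_order_le le_rfl, Finset.sum_mul, add_mul, mul_assoc]
  rw [intervalIntegral.integral_finsetSum fun i _ =>
    ((hK i (-t)).const_mul (R.refl.coeff i)).add ((hK i t).const_mul (R.plain.coeff i))]
  refine Finset.sum_congr rfl fun i _ => ?_
  rw [intervalIntegral.integral_add ((hK i (-t)).const_mul _) ((hK i t).const_mul _),
    intervalIntegral.integral_const_mul, intervalIntegral.integral_const_mul]

end ToEnd

namespace Jet

/-- The jet of `t ↦ ∫ s in -T..t, g (t - s) h s`, the solution of `S u = h` with vanishing data
at `-T`. Its top entry `u^(m)` is corrected by the boundary term `h / c_m`; the entries beyond the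
top one carry no meaning. -/
def duhamelJet (S : ℝ[X]) (g : Jet) (T : ℝ) (h : ℝ → ℝ) : Jet := fun k t =>
  (∫ s in -T..t, g k (t - s) * h s) + if k = S.natDegree then h t / S.leadingCoeff else 0

/-- The jet of `t ↦ ∫ s in -T..T, G t s * h s`, where `G` is the Green's function. -/
def greenIntegralJet {ι : Type*} [Fintype ι] (S : ℝ[X]) (g : Jet) (Λ : ι → Jet →ₗ[ℝ] ℝ)
    (v : ι → Jet) (T : ℝ) (h : ℝ → ℝ) : Jet :=
  duhamelJet S g T h - ∑ i, (∫ s in -T..T, Λ i (halfJet g s) * h s) • v i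

variable {S : ℝ[X]} {g : Jet} {t T : ℝ} {k : ℕ} {h : ℝ → ℝ}

lemma duhamelJet_of_lt (hk : k < S.natDegree) :
    duhamelJet S g T h k t = ∫ s in -T..t, g k (t - s) * h s := by
  rw [duhamelJet, if_neg hk.ne, add_zero]

lemma exists_apply_sub_eq_sum (hS : S ≠ 0) (hg : g ∈ Sol S) : ∃ w : Fin S.natDegree → Jet,
    (∀ j, w j ∈ Sol S) ∧ ∀ k s t, g k (t - s) = ∑ j, w j k t * g j (-s) := by
  refine ⟨fun j => Sol.ofData hS 0 fun i => if j = i then 1 else 0,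
    fun j => Sol.ofData_mem hS 0 _, fun k s t => ?_⟩
  have expansion := (Sol.ofData_self hS 0 (Sol.translate_mem hg s)).symm
  rw [LinearMap.pi_apply_eq_sum_univ] at expansion
  simpa [Finset.sum_apply, mul_comm] using congrFun (congrFun expansion k) t

lemma stepJet_mul_eq_indicator (k : ℕ) (t : ℝ) :
    (fun s => stepJet g s k t * h s) = (Iio t).indicator fun s => g k (t - s) * h s := by
  ext s
  simp [stepJet, indicator_apply, ite_mul]

lemma integral_stepJet (hk : k < S.natDegree) (ht : t ∈ Icc (-T) T) :
    ∫ s in -T..T, stepJet g s k t * h s = duhamelJet S g T h k t := by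
  rw [duhamelJet_of_lt hk, ← intervalIntegral.integral_indicator ht, stepJet_mul_eq_indicator]
  exact intervalIntegral.integral_congr_ae_restrict
    (ae_restrict_of_ae (indicator_ae_eq_of_ae_eq_set Iio_ae_eq_Iic))

section Duhamel

variable (hT : 0 < T) (hg : g ∈ Sol S) (hh : IntegrableOn h (Icc (-T) T))
include hT hh

lemma intervalIntegrable_mul {f : ℝ → ℝ} (hf : Continuous f) (ht : t ∈ Icc (-T) T) :
    IntervalIntegrable (fun s => f s * h s) volume (-T) t :=
  ((hh.mono_set (ordConnected_Icc.uIcc_subset (left_mem_Icc.2 (by linarith)) ht)).intervalIntegrable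
    ).continuousOn_mul hf.continuousOn

lemma integral_apply_sub_eq_sum {w : Fin S.natDegree → Jet} (hg : g ∈ Sol S)
    (hw : ∀ k s t, g k (t - s) = ∑ j, w j k t * g j (-s)) (k : ℕ) (ht : t ∈ Icc (-T) T) :
    ∫ s in -T..t, g k (t - s) * h s = ∑ j, w j k t * ∫ s in -T..t, g j (-s) * h s := by
  simp only [hw, Finset.sum_mul, mul_assoc, ← intervalIntegral.integral_const_mul]
  exact intervalIntegral.integral_finsetSum fun j _ => (intervalIntegrable_mul hT hh
    ((Sol.continuous hg j).comp continuous_neg) ht).const_mul _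

lemma hasDerivAt_duhamelJet (hg : IsFundamental S g) {w : Fin S.natDegree → Jet}
    (hw_mem : ∀ j, w j ∈ Sol S) (hw : ∀ k s t, g k (t - s) = ∑ j, w j k t * g j (-s))
    (hk : k < S.natDegree) (ht : Icc (-T) T ∈ 𝓝 t)
    (hd : ∀ j : Fin S.natDegree,
      HasDerivAt (fun t => ∫ s in -T..t, g j (-s) * h s) (g j (-t) * h t) t) :
    HasDerivAt (duhamelJet S g T h k) (duhamelJet S g T h (k + 1) t) t := by
  have jump : (∑ j, w j k t * g j (-t)) * h t
      = if k + 1 = S.natDegree then h t / S.leadingCoeff else 0 := by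
    rw [← hw, sub_self]
    split_ifs with hk'
    · rw [hg.top k hk', one_div_mul_eq_div]
    · rw [hg.low k (by omega), zero_mul]
  have deriv_eq : duhamelJet S g T h (k + 1) t = ∑ j,
      (w j (k + 1) t * (∫ s in -T..t, g j (-s) * h s) + w j k t * (g j (-t) * h t)) := by
    rw [duhamelJet, ← jump, integral_apply_sub_eq_sum hT hh hg.mem hw _ (mem_of_mem_nhds ht),
      Finset.sum_mul, ← Finset.sum_add_distrib]
    simp only [mul_assoc]
  rw [deriv_eq]
  refine (HasDerivAt.fun_sum fun j _ => ((hw_mem j).1 k t).mul (hd j)).congr_of_eventuallyEq ?_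
  filter_upwards [ht] with x hx
  rw [duhamelJet_of_lt hk, integral_apply_sub_eq_sum hT hh hg.mem hw k hx]
  simp only [Pi.mul_apply]

lemma duhamelJet_mem (hS : S ≠ 0) (hg : IsFundamental S g) :
    duhamelJet S g T h ∈ ACJet T S.natDegree := by
  obtain ⟨w, hw_mem, hw⟩ := exists_apply_sub_eq_sum hS hg.mem
  have hI : uIcc (-T) T = Icc (-T) T := uIcc_of_le (by linarith)
  have integrable (j : ℕ) : IntervalIntegrable (fun s => g j (-s) * h s) volume (-T) T :=
    intervalIntegrable_mul hT hh ((Sol.continuous hg.mem j).comp continuous_neg)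
      (right_mem_Icc.2 (by linarith))
  refine fun k hk => ⟨?_, ?_⟩
  · refine absolutelyContinuousOnInterval_congr
      (absolutelyContinuousOnInterval_sum Finset.univ fun j _ =>
        (Sol.mem_ACJet (hw_mem j) T _ k (Nat.lt_succ_self k)).1.fun_mul
          ((integrable j).absolutelyContinuousOnInterval_intervalIntegral left_mem_uIcc))
      fun t ht => ?_
    rw [Finset.sum_apply, duhamelJet_of_lt hk,
      integral_apply_sub_eq_sum hT hh hg.mem hw k (hI ▸ ht)]
  · have primitive_deriv : ∀ᵐ t ∂(volume.restrict (Icc (-T) T)), ∀ j : Fin S.natDegree,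
        HasDerivAt (fun t => ∫ s in -T..t, g j (-s) * h s) (g j (-t) * h t) t := by
      refine ae_all_iff.2 fun j => (ae_restrict_iff' measurableSet_Icc).2 ?_
      filter_upwards [(integrable j).ae_hasDerivAt_integral] with t ht hmem
        using ht (hI ▸ hmem) (-T) left_mem_uIcc
    filter_upwards [ae_restrict_Icc_mem_nhds (-T) T, primitive_deriv] with t ht hd
      using hasDerivAt_duhamelJet hT hh hg hw_mem hw hk ht hd

include hg

lemma intervalIntegrable_comp_sub_mul (k : ℕ) (a : ℝ) (ht : t ∈ Icc (-T) T) :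
    IntervalIntegrable (fun s => g k (a - s) * h s) volume (-T) t :=
  intervalIntegrable_mul hT hh ((Sol.continuous hg k).comp (continuous_sub_left a)) ht

lemma aeval_shift_duhamelJet (hS : S ≠ 0) (ht : t ∈ Icc (-T) T) :
    aeval shift S (duhamelJet S g T h) 0 t = h t := by
  have integrand_eq_zero (s : ℝ) : ∑ i ∈ Finset.range (S.natDegree + 1),
      S.coeff i * (g i (t - s) * h s) = 0 := by
    have equation := Sol.aeval_eq_zero hg 0 (t - s)
    simp only [aeval_shift_apply_of_le le_rfl, zero_add] at equation
    simp only [← mul_assoc, ← Finset.sum_mul, equation, zero_mul]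
  have integral_eq_zero : ∑ i ∈ Finset.range (S.natDegree + 1),
      S.coeff i * ∫ s in -T..t, g i (t - s) * h s = 0 := by
    simp only [← intervalIntegral.integral_const_mul]
    rw [← intervalIntegral.integral_finsetSum fun i _ =>
      (intervalIntegrable_comp_sub_mul hT hg hh i t ht).const_mul _]
    simp only [integrand_eq_zero, intervalIntegral.integral_zero]
  rw [aeval_shift_apply_of_le le_rfl]
  simp only [zero_add, duhamelJet, mul_add, Finset.sum_add_distrib, integral_eq_zero, mul_ite,
    mul_zero, Finset.sum_ite_eq', Finset.mem_range, lt_add_one, if_true]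
  exact mul_div_cancel₀ _ (Polynomial.leadingCoeff_ne_zero.2 hS)

lemma intervalIntegrable_apply_halfJet {l : Jet →ₗ[ℝ] ℝ} {m : ℕ} (hl : l ∈ TwoPoint T m) :
    IntervalIntegrable (fun s => l (halfJet g s) * h s) volume (-T) T :=
  intervalIntegrable_mul hT hh (continuous_apply_halfJet hT hg hl)
    (right_mem_Icc.2 (by linarith))

lemma TwoPoint.apply_duhamelJet {l : Jet →ₗ[ℝ] ℝ} (hl : l ∈ TwoPoint T S.natDegree) :
    l (duhamelJet S g T h) = ∫ s in -T..T, l (halfJet g s) * h s := by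
  obtain ⟨A, B, hAB⟩ := exists_coeff hl
  have halfJet_left (s : ℝ) (k : ℕ) : halfJet g s k (-T) = 0 := if_neg (by linarith)
  have halfJet_right (s : ℝ) (k : ℕ) : halfJet g s k T = g k (T - s) := if_pos hT
  simp only [hAB, halfJet_left, halfJet_right, mul_zero, zero_add, Finset.sum_mul, mul_assoc]
  rw [intervalIntegral.integral_finsetSum fun (k : Fin S.natDegree) _ =>
    (intervalIntegrable_comp_sub_mul hT hg hh k T (right_mem_Icc.2 (by linarith))).const_mul _]
  refine Finset.sum_congr rfl fun k _ => ?_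
  rw [duhamelJet_of_lt k.2, duhamelJet_of_lt k.2, intervalIntegral.integral_same, mul_zero,
    zero_add, intervalIntegral.integral_const_mul]

lemma intervalIntegrable_stepJet (k : ℕ) (t : ℝ) :
    IntervalIntegrable (fun s => stepJet g s k t * h s) volume (-T) T := by
  have integrable := intervalIntegrable_comp_sub_mul hT hg hh k t (right_mem_Icc.2 (by linarith))
  rw [stepJet_mul_eq_indicator]
  exact ⟨integrable.1.indicator measurableSet_Iio, integrable.2.indicator measurableSet_Iio⟩

end Duhamel

section Green

variable {ι : Type} [Fintype ι] {Λ : ι → Jet →ₗ[ℝ] ℝ} {v : ι → Jet}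

lemma greenJet_mul (k : ℕ) (s t : ℝ) : greenJet g Λ v s k t * h s
    = stepJet g s k t * h s - ∑ i, v i k t * (Λ i (halfJet g s) * h s) := by
  rw [greenJet_apply, sub_mul, Finset.sum_mul]
  exact congrArg _ (Finset.sum_congr rfl fun i _ => by ring)

variable (hT : 0 < T) (hg : g ∈ Sol S) (hΛ : ∀ i, Λ i ∈ TwoPoint T S.natDegree)
  (hh : IntegrableOn h (Icc (-T) T))

section Integral

include hT hg hΛ hh

lemma intervalIntegrable_sum_halfJet (k : ℕ) (t : ℝ) : IntervalIntegrable
    (fun s => ∑ i, v i k t * (Λ i (halfJet g s) * h s)) volume (-T) T := by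
  simpa only [Finset.sum_fn] using IntervalIntegrable.sum Finset.univ fun i _ =>
    (intervalIntegrable_apply_halfJet hT hg hh (hΛ i)).const_mul (v i k t)

lemma intervalIntegrable_greenJet (k : ℕ) (t : ℝ) :
    IntervalIntegrable (fun s => greenJet g Λ v s k t * h s) volume (-T) T := by
  simp only [greenJet_mul]
  exact (intervalIntegrable_stepJet hT hg hh k t).sub
    (intervalIntegrable_sum_halfJet hT hg hΛ hh k t)

lemma integral_greenJet (hk : k < S.natDegree) (ht : t ∈ Icc (-T) T) :
    ∫ s in -T..T, greenJet g Λ v s k t * h s = greenIntegralJet S g Λ v T h k t := by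
  simp only [greenJet_mul]
  rw [intervalIntegral.integral_sub (intervalIntegrable_stepJet hT hg hh k t)
      (intervalIntegrable_sum_halfJet hT hg hΛ hh k t), integral_stepJet hk ht,
    intervalIntegral.integral_finsetSum fun i _ =>
      (intervalIntegrable_apply_halfJet hT hg hh (hΛ i)).const_mul _]
  simp [greenIntegralJet, Finset.sum_apply, mul_comm]

end Integral

variable [DecidableEq ι] (hv : IsDualBasis S Λ v)
include hT hv

lemma greenIntegralJet_mem (hh : IntegrableOn h (Icc (-T) T)) (hS : S ≠ 0)
    (hg : IsFundamental S g) : greenIntegralJet S g Λ v T h ∈ ACJet T S.natDegree :=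
  Submodule.sub_mem _ (duhamelJet_mem hT hh hS hg) (Sol.mem_ACJet (hv.sum_smul_mem _) T _)

include hg

section Turnstile

variable {R : ReflOp} {n : ℕ} (hR : R.order ≤ n) (ht : t ∈ Icc (-T) T)
include hR ht

lemma turnstile_greenJet_ae_eq (h : ℝ → ℝ) :
    (fun s => R.turnstile (Icc (-T) T) (fun t s => greenJet g Λ v s 0 t) t s * h s)
      =ᵐ[volume.restrict (uIoc (-T) T)] fun s => R.toEnd (greenJet g Λ v s) 0 t * h s := by
  refine ae_restrict_of_ae ?_
  filter_upwards [Measure.ae_ne volume t, Measure.ae_ne volume (-t)] with s hs hs'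
  have isJet : IsJet n (Icc (-T) T) {s}ᶜ (greenJet g Λ v s 0) (greenJet g Λ v s) :=
    isJet_greenJet hg hv inter_subset_right
  rw [ReflOp.turnstile, isJet.act_eq_toEnd hR (uniqueDiffOn_Icc (by linarith))
    isOpen_compl_singleton ⟨ht, hs.symm⟩ ⟨neg_mem_Icc_neg ht, hs'.symm⟩]

include hΛ hh

theorem intervalIntegrable_turnstile_greenJet : IntervalIntegrable (fun s =>
    R.turnstile (Icc (-T) T) (fun t s => greenJet g Λ v s 0 t) t s * h s) volume (-T) T :=
  (ReflOp.intervalIntegrable_toEnd_mul R (intervalIntegrable_greenJet hT hg hΛ hh) t).congr_ae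
    (turnstile_greenJet_ae_eq hT hg hv hR ht h).symm

theorem integral_turnstile_greenJet (hn : n < S.natDegree) :
    ∫ s in -T..T, R.turnstile (Icc (-T) T) (fun t s => greenJet g Λ v s 0 t) t s * h s
      = R.toEnd (greenIntegralJet S g Λ v T h) 0 t := by
  rw [intervalIntegral.integral_congr_ae_restrict (turnstile_greenJet_ae_eq hT hg hv hR ht h),
    ReflOp.integral_toEnd_mul R (intervalIntegrable_greenJet hT hg hΛ hh)]
  exact ReflOp.toEnd_congr hR
    (fun i hi => integral_greenJet hT hg hΛ hh (hi.trans_lt hn) (neg_mem_Icc_neg ht))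
    fun i hi => integral_greenJet hT hg hΛ hh (hi.trans_lt hn) ht

end Turnstile

include hh

lemma aeval_shift_greenIntegralJet (hS : S ≠ 0) (ht : t ∈ Icc (-T) T) :
    aeval shift S (greenIntegralJet S g Λ v T h) 0 t = h t := by
  rw [greenIntegralJet, map_sub, (hv.sum_smul_mem _).2, sub_zero,
    aeval_shift_duhamelJet hT hg hh hS ht]

lemma apply_greenIntegralJet {i : ι} (hΛ : Λ i ∈ TwoPoint T S.natDegree) :
    Λ i (greenIntegralJet S g Λ v T h) = 0 := by
  rw [greenIntegralJet, map_sub, TwoPoint.apply_duhamelJet hT hg hh hΛ, hv.apply_sum_smul, sub_self]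

end Green

end Jet

/-! ### Unique solvability of the boundary value problem -/

/-- The counterpart on jets of `IsSolution`, the boundary functionals being those of `Λ`. -/
structure IsSolutionJet {ι : Type} (T : ℝ) (m : ℕ) (L : ReflOp) (Λ : ι → Jet →ₗ[ℝ] ℝ)
    (h : ℝ → ℝ) (F : Jet) : Prop where
  mem : F ∈ ACJet T m
  equation : ∀ᵐ t ∂(volume.restrict (Icc (-T) T)), L.toEnd F 0 t = h t
  apply_eq_zero : ∀ i, Λ i F = 0

section IsSolutionJet

variable {ι : Type} {T : ℝ} {m : ℕ} {L : ReflOp} {C : ι → (ℝ → ℝ) → ℝ} {Λ : ι → Jet →ₗ[ℝ] ℝ}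
  {h h' u : ℝ → ℝ} {F G : Jet}

lemma IsSolutionJet.sub (hF : IsSolutionJet T m L Λ h F) (hG : IsSolutionJet T m L Λ h' G) :
    IsSolutionJet T m L Λ (h - h') (F - G) where
  mem := Submodule.sub_mem _ hF.mem hG.mem
  equation := by
    filter_upwards [hF.equation, hG.equation] with t hFt hGt
    rw [map_sub, Pi.sub_apply, Pi.sub_apply, Pi.sub_apply, hFt, hGt]
  apply_eq_zero i := by rw [map_sub, hF.apply_eq_zero, hG.apply_eq_zero, sub_zero]

variable (hT : 0 < T) (hm : 0 < m) (hL : L.order ≤ m) (hC : Represents T m C Λ)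
include hT hm hC

lemma Represents.apply_eq_of_mem_ACJet (hF : F ∈ ACJet T m) (hu : ∀ t ∈ Icc (-T) T, u t = F 0 t)
    (i : ι) : C i u = Λ i F :=
  hC univ isOpen_univ (fun _ _ => mem_univ _) (mem_univ T) u F
    (ACJet.isJet hT hF (Nat.sub_lt hm one_pos) hu) i

include hL

lemma IsSolutionJet.isSolution (hF : IsSolutionJet T m L Λ h F)
    (hu : ∀ t ∈ Icc (-T) T, u t = F 0 t) : IsSolution T m L C h u where
  regular := ACJet.isSobolev hT hF.mem hu
  equation := by
    filter_upwards [ACJet.ae_act_eq_toEnd hT hL hF.mem hu, hF.equation] with t hact heq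
      using hact.trans heq
  conditions i := (hC.apply_eq_of_mem_ACJet hT hm hF.mem hu i).trans (hF.apply_eq_zero i)

lemma IsSolution.isSolutionJet (hu : IsSolution T m L C h u) :
    IsSolutionJet T m L Λ h (jetOf T u) where
  mem := hu.regular.jetOf_mem_ACJet hT
  equation := by
    have hact := ACJet.ae_act_eq_toEnd hT hL (hu.regular.jetOf_mem_ACJet hT) (u := u)
      fun t _ => by rw [jetOf_zero]
    filter_upwards [hact, hu.equation] with t hact heq using hact.symm.trans heq
  apply_eq_zero i := (hC.apply_eq_of_mem_ACJet hT hm (hu.regular.jetOf_mem_ACJet hT)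
    (fun t _ => by rw [jetOf_zero]) i).symm.trans (hu.conditions i)

end IsSolutionJet

lemma Jet.Sol.eq_zero_of_apply_eq_zero {ι : Type} {T : ℝ} {S : ℝ[X]} {C : ι → (ℝ → ℝ) → ℝ}
    {Λ : ι → Jet →ₗ[ℝ] ℝ} (hT : 0 < T) (hS : 0 < S.natDegree) (hC : Represents T S.natDegree C Λ)
    (htriv : ∀ u : ℝ → ℝ, IsSolution T S.natDegree (ReflOp.ofPoly S) C (fun _ => 0) u →
      ∀ t ∈ Icc (-T) T, u t = 0) {F : Jet} (hF : F ∈ Sol S) (hΛF : ∀ i, Λ i F = 0) : F = 0 := by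
  have solution : IsSolutionJet T S.natDegree (ReflOp.ofPoly S) Λ (fun _ => 0) F :=
    ⟨Sol.mem_ACJet hF T _, .of_forall fun t => by
      rw [ReflOp.toEnd_ofPoly, Sol.aeval_eq_zero hF], hΛF⟩
  have order_le : (ReflOp.ofPoly S).order ≤ S.natDegree :=
    ReflOp.order_le_iff.2 ⟨Nat.zero_le _, le_rfl⟩
  exact Sol.eq_zero_of_Icc (Polynomial.ne_zero_of_natDegree_gt hS) hF (by linarith)
    (htriv (F 0) (solution.isSolution hT hS order_le hC fun _ _ => rfl))

lemma ker_le_ker_of_surjective {K V W : Type*} [DivisionRing K] [AddCommGroup V] [Module K V]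
    [AddCommGroup W] [Module K W] [FiniteDimensional K W] {f g : V →ₗ[K] W}
    (hg : Function.Surjective g) (hfg : f.ker ≤ g.ker) : g.ker ≤ f.ker := by
  obtain ⟨r, hr⟩ := g.exists_rightInverse_of_surjective (LinearMap.range_eq_top.2 hg)
  have g_r (x : W) : g (r x) = x := LinearMap.congr_fun hr x
  have f_r_injective : Function.Injective (f ∘ₗ r) :=
    (injective_iff_map_eq_zero _).2 fun x hx => by rw [← g_r x]; exact hfg hx
  intro y hy
  obtain ⟨x, hx⟩ := LinearMap.injective_iff_surjective.1 f_r_injective (f y)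
  have x_eq_zero : x = 0 := by
    have : g (r x - y) = 0 := hfg (by rw [LinearMap.mem_ker, map_sub, sub_eq_zero]; exact hx)
    rwa [map_sub, g_r, LinearMap.mem_ker.1 hy, sub_zero] at this
  rw [LinearMap.mem_ker, ← hx, x_eq_zero, map_zero]

/-- The jets of the solutions of `L u = 0` in `W^{n,1}([-T, T])`. -/
def ACSol (T : ℝ) (n : ℕ) (L : ReflOp) : Submodule ℝ Jet where
  carrier := {F | F ∈ ACJet T n ∧ ∀ᵐ t ∂(volume.restrict (Icc (-T) T)), L.toEnd F 0 t = 0}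
  add_mem' := by
    rintro F G ⟨hF, hLF⟩ ⟨hG, hLG⟩
    refine ⟨Submodule.add_mem _ hF hG, ?_⟩
    filter_upwards [hLF, hLG] with t hFt hGt
    rw [map_add, Pi.add_apply, Pi.add_apply, hFt, hGt, add_zero]
  zero_mem' := ⟨Submodule.zero_mem _, .of_forall fun t => by rw [map_zero]; rfl⟩
  smul_mem' := by
    rintro c F ⟨hF, hLF⟩
    refine ⟨Submodule.smul_mem _ c hF, ?_⟩
    filter_upwards [hLF] with t hFt
    rw [map_smul, Pi.smul_apply, Pi.smul_apply, hFt, smul_zero]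

lemma ReflOp.toEnd_toEnd_reducer (L : ReflOp) (F : Jet) :
    L.toEnd (L.reducer.toEnd F) = aeval shift L.reduced F := by
  rw [← Module.End.mul_apply, ← toEnd_mul, mul_reducer, toEnd_ofPoly]

section Reduction

variable {L : ReflOp} {T : ℝ} {n : ℕ} {α β : Fin n → Fin n → ℝ} {v : Fin n ⊕ Fin n → Jet}
  (hL : L.order ≤ n)
include hL

lemma toEnd_reducer_mem_ACJet {F : Jet} (hF : F ∈ ACJet T (2 * n)) :
    L.reducer.toEnd F ∈ ACJet T n :=
  ACJet.toEnd_mem (L.order_reducer.trans_le hL) (two_mul n ▸ hF)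

lemma exists_mem_ACSol_bdryJet_eq
    (hv : IsDualBasis L.reduced (reducedJet T α β L.reducer) v) (x : Fin n → ℝ) :
    ∃ F ∈ ACSol T n L, ∀ i, bdryJet T α β i F = x i := by
  have mem := hv.sum_smul_mem (Sum.elim x 0)
  refine ⟨L.reducer.toEnd (∑ i, Sum.elim x 0 i • v i),
    ⟨toEnd_reducer_mem_ACJet hL (Sol.mem_ACJet mem T _), .of_forall fun t => ?_⟩,
    fun i => hv.apply_sum_smul (Sum.elim x 0) (Sum.inl i)⟩
  rw [L.toEnd_toEnd_reducer, Sol.aeval_eq_zero mem]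

variable (hT : 0 < T) (hn : 0 < n) (hS : L.reduced.natDegree = 2 * n)
include hT hn hS

lemma ACSol.apply_eq_zero {F : Jet} (hF : F ∈ ACSol T n L) (hF₀ : data n 0 F = 0) {k : ℕ}
    (hk : k < n) {t : ℝ} (ht : t ∈ Icc (-T) T) : F k t = 0 :=
  ACJet.eq_zero_of_data_eq_zero hT hL (L.coeff_sq_sub_coeff_sq_ne_zero hn.ne' hL hS) hF.1 hF.2
    (fun k hk => congrFun hF₀ ⟨k, hk⟩) hk ht

theorem IsSolutionJet.eq_zero (hv : IsDualBasis L.reduced (reducedJet T α β L.reducer) v) {F : Jet}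
    (hF : IsSolutionJet T n L (bdryJet T α β) 0 F) {t : ℝ} (ht : t ∈ Icc (-T) T) : F 0 t = 0 := by
  let f : ACSol T n L →ₗ[ℝ] (Fin n → ℝ) := data n 0 ∘ₗ (ACSol T n L).subtype
  let g : ACSol T n L →ₗ[ℝ] (Fin n → ℝ) := LinearMap.pi (bdryJet T α β) ∘ₗ (ACSol T n L).subtype
  have g_surjective : Function.Surjective g := fun x =>
    let ⟨G, hG, hGx⟩ := exists_mem_ACSol_bdryJet_eq hL hv x
    ⟨⟨G, hG⟩, funext hGx⟩
  have ker_le : f.ker ≤ g.ker := fun G hG => funext fun i => by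
    have G_eq_zero {k : ℕ} (hk : k < n) {t : ℝ} (ht : t ∈ Icc (-T) T) : (G : Jet) k t = 0 :=
      ACSol.apply_eq_zero hL hT hn hS G.2 hG hk ht
    exact (TwoPoint.apply_congr (G := 0) (bdryJet_mem_twoPoint α β le_rfl i)
      (fun k hk => G_eq_zero hk (left_mem_Icc.2 (by linarith)))
      (fun k hk => G_eq_zero hk (right_mem_Icc.2 (by linarith)))).trans (map_zero _)
  have data_eq_zero : data n 0 F = 0 := ker_le_ker_of_surjective g_surjective ker_le
    (show (⟨F, hF.mem, hF.equation⟩ : ACSol T n L) ∈ g.ker from funext hF.apply_eq_zero)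
  exact ACSol.apply_eq_zero hL hT hn hS ⟨hF.mem, hF.equation⟩ data_eq_zero hn ht

lemma isSolutionJet_greenIntegralJet {g : Jet} {h : ℝ → ℝ} (hg : IsFundamental L.reduced g)
    (hΛ : ∀ i, reducedJet T α β L.reducer i ∈ TwoPoint T L.reduced.natDegree)
    (hv : IsDualBasis L.reduced (reducedJet T α β L.reducer) v)
    (hh : IntegrableOn h (Icc (-T) T)) :
    IsSolutionJet T n L (bdryJet T α β) h (L.reducer.toEnd
      (greenIntegralJet L.reduced g (reducedJet T α β L.reducer) v T h)) where
  mem := toEnd_reducer_mem_ACJet hL (hS ▸ greenIntegralJet_mem hT hv hh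
    (Polynomial.ne_zero_of_natDegree_gt (n := 0) (by omega)) hg)
  equation := by
    filter_upwards [ae_restrict_mem measurableSet_Icc] with t ht
    rw [L.toEnd_toEnd_reducer, aeval_shift_greenIntegralJet hT hg.mem hh hv
      (Polynomial.ne_zero_of_natDegree_gt (n := 0) (by omega)) ht]
  apply_eq_zero i := apply_greenIntegralJet hT hg.mem hh hv (hΛ (Sum.inl i))

end Reduction

end

end ReflectionBVP

open ReflectionBVP ReflectionBVP.Jet

theorem theorem3p2 (L : ReflectionBVP.ReflOp) :
    ∃ (R : ReflectionBVP.ReflOp) (S : ℝ[X]),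
      (∀ k : ℕ, R.refl.coeff k = L.refl.coeff k) ∧
      (∀ l : ℕ, R.plain.coeff l = (-1 : ℝ) ^ (l + 1) * L.plain.coeff l) ∧
      R * L = ReflectionBVP.ReflOp.ofPoly S ∧
      ∀ (T : ℝ), 0 < T → ∀ (n : ℕ), 1 ≤ n →
      -- `L` has order at most `n`, and the reduced problem, with its `2n` conditions, order `2n`
      L.refl.natDegree ≤ n → L.plain.natDegree ≤ n → S.natDegree = 2 * n →
      ∀ (α β : Fin n → Fin n → ℝ),
      -- the reduced homogeneous problem has only the trivial solution
      (∀ u : ℝ → ℝ,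
        ReflectionBVP.IsSolution T (2 * n) (ReflectionBVP.ReflOp.ofPoly S)
          (ReflectionBVP.reducedBdry T α β R) (fun _ => 0) u →
        ∀ t ∈ Icc (-T) T, u t = 0) →
      ∃ G : ℝ → ℝ → ℝ,
        -- `G` is the unique Green's function of the reduced problem
        ReflectionBVP.IsGreen T S (ReflectionBVP.reducedBdry T α β R) G ∧
        (∀ G' : ℝ → ℝ → ℝ,
          ReflectionBVP.IsGreen T S (ReflectionBVP.reducedBdry T α β R) G' →
          ∀ t ∈ Icc (-T) T, ∀ s ∈ Icc (-T) T, G' t s = G t s) ∧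
        ∀ h : ℝ → ℝ, IntegrableOn h (Icc (-T) T) →
          -- the integral makes sense, and it is the unique solution of the original problem
          (∀ t ∈ Icc (-T) T,
            IntervalIntegrable (fun s => R.turnstile (Icc (-T) T) G t s * h s) volume (-T) T) ∧
          ReflectionBVP.IsSolution T n L (ReflectionBVP.bdry T α β) h
            (fun t => ∫ s in (-T)..T, R.turnstile (Icc (-T) T) G t s * h s) ∧
          ∀ w : ℝ → ℝ, ReflectionBVP.IsSolution T n L (ReflectionBVP.bdry T α β) h w →
            ∀ t ∈ Icc (-T) T, w t = ∫ s in (-T)..T, R.turnstile (Icc (-T) T) G t s * h s := by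
  refine ⟨L.reducer, L.reduced, fun _ => rfl, L.coeff_reducer_plain, L.reducer_mul, ?_⟩
  intro T hT n hn hrefl hplain hS α β htriv
  have hL : L.order ≤ n := ReflOp.order_le_iff.2 ⟨hrefl, hplain⟩
  have hR : L.reducer.order ≤ n := L.order_reducer.trans_le hL
  have hS₀ : L.reduced ≠ 0 := Polynomial.ne_zero_of_natDegree_gt (n := 0) (by omega)
  have hB : Represents T n (bdry T α β) (bdryJet T α β) := represents_bdry α β hT
  have hC := represents_reducedBdry α β hR hT
  have hΛ := reducedJet_mem_twoPoint (T := T) α β hR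
  rw [← hS] at hC hΛ htriv
  obtain ⟨g, hg⟩ := exists_isFundamental hS₀
  obtain ⟨v, hv⟩ := exists_isDualBasis hS₀ (by simp [hS, two_mul]) fun F hF =>
    Sol.eq_zero_of_apply_eq_zero hT (by omega) hC htriv hF
  refine ⟨fun t s => greenJet g (reducedJet T α β L.reducer) v s 0 t,
    isGreen_greenJet hT hg hΛ hv hC,
    fun G hG t ht s hs => eq_greenJet (by omega) hT hg hΛ hv hC hG ht hs, fun h hh => ?_⟩
  have hF := isSolutionJet_greenIntegralJet hL hT hn hS hg hΛ hv hh
  have integral_eq (t : ℝ) (ht : t ∈ Icc (-T) T) :=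
    integral_turnstile_greenJet hT hg.mem hΛ hh hv hR ht (by omega)
  refine ⟨fun t ht => intervalIntegrable_turnstile_greenJet hT hg.mem hΛ hh hv hR ht,
    hF.isSolution hT hn hL hB integral_eq, fun w hw t ht => ?_⟩
  have hdiff := (hw.isSolutionJet hT hn hL hB).sub hF
  rw [sub_self] at hdiff
  rw [integral_eq t ht, ← sub_eq_zero, ← jetOf_zero T w]
  exact hdiff.eq_zero hL hT hn hS hv ht
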